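/- Let $n\ge 0$ and $0<q<1$. Let $\mathbb Y_n$ be the set of Young diagrams with $n$ boxes, and for $\lambda\in\mathbb Y_n$ put $$M_q^{(n)}(\lambda)=(1-q)^n\,\dim\lambda\;\frac{q^{b(\lambda)}}{\prod_{u\in\lambda}[h(u)]},$$ where $[k]=1-q^k$, $\dim\lambda$ is the number of standard Young tableaux of shape $\lambda$, $b(\lambda)=\sum_i (i-1)\lambda_i$, and $h(u)=\lambda_i-i+\lambda'_j-j+1$ is the hook length of the box $u$ in row $i$ and column $j$ ($\lambda_i$ is the length of row $i$ and $\lambda'_j$ the length of column $j$). For a permutation $\sigma\in S(n)$ let $\mathrm{maj}(\sigma)=\sum i$, the sum over all $1\le i\le n-1$ with $\sigma(i)>\sigma(i+1)$, and let $\mathbb P$ be the probability distribution on $S(n)$ given by $$\mathbb P(\sigma)=\frac{q^{\mathrm{maj}(\sigma)}}{\sum_{\tau\in S(n)}q^{\mathrm{maj}(\tau)}}.$$ Let $\mathrm{sh}(\sigma)\in\mathbb Y_n$ be the shape of the tableaux $(P(\sigma),Q(\sigma))$ that the Robinson–Schensted–Knuth correspondence attaches to $\sigma$, that is, the shape of the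 tableau $P(\sigma)$ obtained by successive row insertion of $\sigma(1),\dots,\sigma(n)$. Then $M_q^{(n)}$ is a probability distribution on $\mathbb Y_n$ (that is, $M_q^{(n)}\ge 0$ and $\sum_{\lambda\in\mathbb Y_n}M_q^{(n)}(\lambda)=1$), and it is the push-forward of $\mathbb P$ under $\mathrm{sh}$: for every $\lambda\in\mathbb Y_n$, $$\mathbb P\{\sigma\in S(n):\mathrm{sh}(\sigma)=\lambda\}=M_q^{(n)}(\lambda).$$ -/

import Mathlib

/-! Conventions: cells of a Young diagram are `(i, j)` with row and column indices starting
from `0`, and `S(n)` is `Equiv.Perm (Fin n)`, so the letter `i : Fin n` stands for `i + 1`. -/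

namespace QPlancherel

/-! ### Young diagrams with `n` boxes, hook lengths, standard tableaux -/

/-- The set `𝕐ₙ` of Young diagrams with `n` boxes. -/
abbrev Diagram (n : ℕ) : Type := {μ : YoungDiagram // μ.card = n}

/-- `h(u) = λ_i - i + λ'_j - j + 1` for a box `u` of the diagram; with indices starting from `0`
this is `(λ_i - j) + (λ'_j - i) - 1`, and no subtraction truncates when `u` is a box. -/
def hookLength (μ : YoungDiagram) (u : ℕ × ℕ) : ℕ :=
  (μ.rowLen u.1 - u.2) + (μ.colLen u.2 - u.1) - 1

/-- `b(λ) = ∑ (i - 1) λ_i`, the sum over the nonzero rows. -/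
def bStat (μ : YoungDiagram) : ℕ :=
  ∑ i ∈ Finset.range (μ.colLen 0), i * μ.rowLen i

/-- A standard Young tableau of shape `μ`: a bijective filling of the boxes with `|μ|` consecutive
integers (the value `k : Fin μ.card` stands for the entry `k + 1`), increasing along rows and
down columns. -/
structure StandardTableau (μ : YoungDiagram) where
  entry : {u : ℕ × ℕ // u ∈ μ} ≃ Fin μ.card
  row_lt : ∀ u v : {u : ℕ × ℕ // u ∈ μ}, u.1.1 = v.1.1 → u.1.2 < v.1.2 → entry u < entry v
  col_lt : ∀ u v : {u : ℕ × ℕ // u ∈ μ}, u.1.2 = v.1.2 → u.1.1 < v.1.1 → entry u < entry v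

/-- `dim λ`, the number of standard Young tableaux of shape `λ`. -/
noncomputable def dim (μ : YoungDiagram) : ℕ := Nat.card (StandardTableau μ)

/-- `M_q^{(n)}(λ) = (1 - q)^n · dim λ · q^{b(λ)} / ∏_{u ∈ λ} [h(u)]`, where `[k] = 1 - q^k`. -/
noncomputable def qPlancherel (n : ℕ) (q : ℝ) (μ : Diagram n) : ℝ :=
  (1 - q) ^ n * (dim μ.1 : ℝ) *
    (q ^ bStat μ.1 / ∏ u ∈ μ.1.cells, (1 - q ^ hookLength μ.1 u))

/-! ### The major index and the distribution on permutations -/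

/-- `maj(σ)`: the sum of the descents of `σ`.  The summand for `i : Fin n` is about the position
`i + 1` of the one-line notation, which is a descent when it is not the last position and its
letter is larger than the next one. -/
def maj {n : ℕ} (σ : Equiv.Perm (Fin n)) : ℕ :=
  ∑ i : Fin n, if ∃ h : (i : ℕ) + 1 < n, σ ⟨i + 1, h⟩ < σ i then (i : ℕ) + 1 else 0

/-- The probability distribution `ℙ(σ) = q^{maj(σ)} / ∑_τ q^{maj(τ)}` on `S(n)`. -/
noncomputable def majPMF (n : ℕ) (q : ℝ) (hq : 0 < q) : PMF (Equiv.Perm (Fin n)) :=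
  PMF.ofFintype
    (fun σ => ENNReal.ofReal (q ^ maj σ / ∑ τ : Equiv.Perm (Fin n), q ^ maj τ)) (by
      have hpos : 0 < ∑ τ : Equiv.Perm (Fin n), q ^ maj τ :=
        Finset.sum_pos (fun τ _ => pow_pos hq _) Finset.univ_nonempty
      rw [← ENNReal.ofReal_sum_of_nonneg (fun σ _ => by positivity), ← Finset.sum_div,
        div_self hpos.ne', ENNReal.ofReal_one])

/-! ### Row insertion and the shape of the Robinson-Schensted-Knuth tableaux -/

/-- Insertion of `x` into a row: `x` replaces the leftmost entry larger than `x`, and that entry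
is returned; if there is none, `x` is put at the end of the row. -/
def rowInsert (x : ℕ) : List ℕ → List ℕ × Option ℕ
  | [] => ([x], none)
  | a :: r => if x < a then (x :: r, some a) else (a :: (rowInsert x r).1, (rowInsert x r).2)

/-- Row insertion of `x` into a tableau (the list of its rows): `x` is inserted into the first row,
and an entry that is bumped is inserted into the rows below. -/
def insertTableau (x : ℕ) : List (List ℕ) → List (List ℕ)
  | [] => [[x]]
  | r :: T =>
    match rowInsert x r with
    | (r', none) => r' :: T
    | (r', some y) => r' :: insertTableau y T

/-- The insertion tableau `P(σ)`: the letters `σ(1), …, σ(n)` are inserted successively into the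
empty tableau. -/
def pTableau {n : ℕ} (σ : Equiv.Perm (Fin n)) : List (List ℕ) :=
  (List.ofFn fun i => (σ i : ℕ)).foldl (fun T x => insertTableau x T) []

/-- `Dom r s`: the row `s` is not longer than the row `r`, and each entry of `s` is larger than the
entry of `r` in the same column. -/
def Dom : List ℕ → List ℕ → Prop
  | _, [] => True
  | [], _ :: _ => False
  | a :: r, b :: s => a < b ∧ Dom r s

theorem Dom.length_le : ∀ {r s : List ℕ}, Dom r s → s.length ≤ r.length
  | _, [], _ => by simp
  | [], _ :: _, h => h.elim
  | _ :: _, _ :: _, h => by simpa using Dom.length_le h.2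

theorem lt_of_rowInsert {x y : ℕ} : ∀ {r : List ℕ}, (rowInsert x r).2 = some y → x < y
  | [], h => by simp [rowInsert] at h
  | a :: r, h => by
    by_cases hx : x < a
    · simp [rowInsert, hx] at h
      omega
    · simp [rowInsert, hx] at h
      exact lt_of_rowInsert h

theorem length_rowInsert_none {x : ℕ} :
    ∀ {r : List ℕ}, (rowInsert x r).2 = none → (rowInsert x r).1.length = r.length + 1
  | [], _ => by simp [rowInsert]
  | a :: r, h => by
    by_cases hx : x < a
    · simp [rowInsert, hx] at h
    · simp [rowInsert, hx] at h
      simp [rowInsert, hx, length_rowInsert_none h]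

theorem length_rowInsert_some {x y : ℕ} :
    ∀ {r : List ℕ}, (rowInsert x r).2 = some y → (rowInsert x r).1.length = r.length
  | [], h => by simp [rowInsert] at h
  | a :: r, h => by
    by_cases hx : x < a
    · simp [rowInsert, hx]
    · simp [rowInsert, hx] at h
      simp [rowInsert, hx, length_rowInsert_some h]

theorem Dom.rowInsert_left (x : ℕ) : ∀ {r s : List ℕ}, Dom r s → Dom (rowInsert x r).1 s
  | _, [], _ => by simp [Dom]
  | [], _ :: _, h => h.elim
  | a :: r, b :: s, h => by
    by_cases hx : x < a
    · simpa [rowInsert, hx, Dom] using ⟨hx.trans h.1, h.2⟩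
    · simpa [rowInsert, hx, Dom] using ⟨h.1, Dom.rowInsert_left x h.2⟩

theorem Dom.rowInsert_both {x y : ℕ} : ∀ {r s : List ℕ}, Dom r s → (rowInsert x r).2 = some y →
    Dom (rowInsert x r).1 (rowInsert y s).1
  | [], _, _, hy => by simp [rowInsert] at hy
  | a :: r, s, h, hy => by
    by_cases hx : x < a
    · simp [rowInsert, hx] at hy
      subst hy
      cases s with
      | nil => simp [rowInsert, hx, Dom]
      | cons b s => simpa [rowInsert, hx, Dom, h.1] using h.2
    · simp [rowInsert, hx] at hy
      have hxy := lt_of_rowInsert hy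
      cases s with
      | nil =>
        simp [rowInsert, hx, Dom]
        omega
      | cons b s =>
        by_cases hb : y < b
        · simp only [rowInsert, hx, hb, Dom, if_true, if_false]
          exact ⟨by omega, h.2.rowInsert_left x⟩
        · simp only [rowInsert, hx, hb, Dom, if_false]
          exact ⟨h.1, h.2.rowInsert_both hy⟩

theorem insertTableau_cons_none {x : ℕ} {r : List ℕ} {T : List (List ℕ)}
    (h : (rowInsert x r).2 = none) : insertTableau x (r :: T) = (rowInsert x r).1 :: T := by
  rcases hr : rowInsert x r with ⟨r', o⟩
  rw [hr] at h
  simp only at h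
  subst h
  simp [insertTableau, hr]

theorem insertTableau_cons_some {x y : ℕ} {r : List ℕ} {T : List (List ℕ)}
    (h : (rowInsert x r).2 = some y) :
    insertTableau x (r :: T) = (rowInsert x r).1 :: insertTableau y T := by
  rcases hr : rowInsert x r with ⟨r', o⟩
  rw [hr] at h
  simp only at h
  subst h
  simp [insertTableau, hr]

theorem head_insertTableau (x : ℕ) (r : List ℕ) (T : List (List ℕ)) :
    ∃ T', insertTableau x (r :: T) = (rowInsert x r).1 :: T' := by
  cases h : (rowInsert x r).2 with
  | none => exact ⟨_, insertTableau_cons_none h⟩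
  | some y => exact ⟨_, insertTableau_cons_some h⟩

theorem isChain_insertTableau (x : ℕ) (T : List (List ℕ)) (hT : T.IsChain Dom) :
    (insertTableau x T).IsChain Dom := by
  induction T generalizing x with
  | nil => simp [insertTableau]
  | cons r T ih =>
    cases h : (rowInsert x r).2 with
    | none =>
      rw [insertTableau_cons_none h]
      cases T with
      | nil => simp
      | cons s T =>
        rw [List.isChain_cons_cons] at hT ⊢
        exact ⟨hT.1.rowInsert_left x, hT.2⟩
    | some y =>
      rw [insertTableau_cons_some h]
      cases T with
      | nil =>
        have h0 : Dom (rowInsert x r).1 (rowInsert y []).1 :=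
          Dom.rowInsert_both (s := []) (by simp [Dom]) h
        simpa [insertTableau, rowInsert] using h0
      | cons s T =>
        rw [List.isChain_cons_cons] at hT
        have h1 := ih y hT.2
        obtain ⟨T', hT'⟩ := head_insertTableau y s T
        rw [hT'] at h1 ⊢
        exact List.isChain_cons_cons.2 ⟨hT.1.rowInsert_both h, h1⟩

theorem sum_insertTableau (x : ℕ) (T : List (List ℕ)) :
    ((insertTableau x T).map List.length).sum = (T.map List.length).sum + 1 := by
  induction T generalizing x with
  | nil => simp [insertTableau]
  | cons r T ih =>
    cases h : (rowInsert x r).2 with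
    | none =>
      rw [insertTableau_cons_none h]
      simp [length_rowInsert_none h]
      omega
    | some y =>
      rw [insertTableau_cons_some h]
      simp [length_rowInsert_some h, ih]
      omega

theorem foldl_insertTableau (w : List ℕ) (T : List (List ℕ)) (hT : T.IsChain Dom) :
    (w.foldl (fun T x => insertTableau x T) T).IsChain Dom ∧
      ((w.foldl (fun T x => insertTableau x T) T).map List.length).sum =
        (T.map List.length).sum + w.length := by
  induction w generalizing T with
  | nil => simpa using hT
  | cons x w ih =>
    have h := ih (insertTableau x T) (isChain_insertTableau x T hT)
    rw [sum_insertTableau] at h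
    simp only [List.foldl_cons, List.length_cons]
    exact ⟨h.1, by rw [h.2]; omega⟩

theorem sortedGE_lengths (T : List (List ℕ)) (hT : T.IsChain Dom) :
    (T.map List.length).SortedGE := by
  rw [List.sortedGE_iff_isChain, List.isChain_map]
  exact hT.imp fun _ _ h => h.length_le

theorem card_ofRowLens (w : List ℕ) (hw : w.SortedGE) :
    (YoungDiagram.ofRowLens w hw).card = w.sum := by
  have key : ∀ w : List ℕ, (YoungDiagram.cellsOfRowLens w).card = w.sum := by
    intro w
    induction w with
    | nil => simp [YoungDiagram.cellsOfRowLens]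
    | cons a w ih =>
      rw [YoungDiagram.cellsOfRowLens, Finset.card_union_of_disjoint]
      · simp [ih]
      · rw [Finset.disjoint_left]
        rintro ⟨i, j⟩ h1 h2
        simp at h1 h2
        omega
  exact key w

/-- The shape map `σ ↦ sh(P(σ)) = sh(Q(σ))` of the Robinson-Schensted-Knuth correspondence: the
Young diagram whose row lengths are those of the insertion tableau. -/
def rskShape {n : ℕ} (σ : Equiv.Perm (Fin n)) : Diagram n :=
  ⟨YoungDiagram.ofRowLens ((pTableau σ).map List.length)
      (sortedGE_lengths _ (foldl_insertTableau _ [] List.isChain_nil).1), by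
    rw [card_ofRowLens]
    simpa [pTableau] using (foldl_insertTableau (List.ofFn fun i => (σ i : ℕ)) [] List.isChain_nil).2⟩

end QPlancherel

/-! The heart of the matter is that the weight of a single fibre of `σ ↦ P(σ)` depends only on the
shape: for each standard tableau `T` of shape `λ` with `n` boxes, the sum of `q^maj` over the words
with insertion tableau `T` is `(1 - q)⋯(1 - qⁿ) · s_λ(1, q, q², …)`. There are `dim λ` such
tableaux, MacMahon's formula gives the normalising sum `(1 - q)⋯(1 - qⁿ) / (1 - q)ⁿ`, and the
principal specialisation is `s_λ(1, q, q², …) = q^b(λ) / ∏ [h(u)]`; the quotient is `M_q^{(n)}(λ)`.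

The fibre sum (`sum_words`) is found without recording tableaux, by removing the last letter. By the
row bumping lemma (`insRow_lt_insRow_iff`), the last two letters form a descent exactly when the
last box lies in a strictly lower row than the one before it. Reverse insertion shows that `T` and a
corner of it determine the last letter and the previous tableau. Thus only the row of the last box
has to be remembered.

The matching algebra uses the Jacobi-Trudi determinant `D(r)` whose rows before `r` are specialised
at `(q, q², …)` and the others at `(1, q, q², …)`. Since `h_k(1, q, …) - h_k(q, q², …) = h_{k-1}(1,
q, …)`, the difference `D(r) - D(r + 1)` is the determinant `D(r)` of the shape with one box removed
from row `r` (`det_jacobiTrudi_sub`). It vanishes when row `r` has no corner, and otherwise matches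
the words whose last box is in row `r`. The sum over `r` telescopes, and homogeneity gives `D(L) =
q^n D(0)`.

The hook formula for `D(0)` (`det_jacobiTrudi_eq`) is a Vandermonde evaluation, and MacMahon's
formula (`sum_arrangements_pow_revMaj`) follows from a version refined by the last letter. -/

namespace QPlancherel

/-! ### Row insertion -/

theorem mem_rowInsert {x z : ℕ} : ∀ {r : List ℕ}, z ∈ (rowInsert x r).1 → z = x ∨ z ∈ r
  | [], h => by simpa [rowInsert] using h
  | a :: r, h => by
    by_cases hx : x < a
    · simp only [rowInsert, hx, if_true, List.mem_cons] at h ⊢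
      tauto
    · simp only [rowInsert, hx, if_false, List.mem_cons] at h ⊢
      rcases h with h | h
      · tauto
      · have := mem_rowInsert h
        tauto

theorem pairwise_rowInsert (x : ℕ) :
    ∀ {r : List ℕ}, r.Pairwise (· ≤ ·) → (rowInsert x r).1.Pairwise (· ≤ ·)
  | [], _ => by simp [rowInsert]
  | a :: r, h => by
    rw [List.pairwise_cons] at h
    by_cases hx : x < a
    · simp only [rowInsert, hx, if_true, List.pairwise_cons]
      exact ⟨fun b hb => hx.le.trans (h.1 b hb), h.2⟩
    · simp only [rowInsert, hx, if_false, List.pairwise_cons]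
      refine ⟨fun b hb => ?_, pairwise_rowInsert x h.2⟩
      rcases mem_rowInsert hb with rfl | hb
      · omega
      · exact h.1 b hb

theorem rowInsert_ne_nil (x : ℕ) (r : List ℕ) : (rowInsert x r).1 ≠ [] := by
  cases r with
  | nil => simp [rowInsert]
  | cons a r => by_cases hx : x < a <;> simp [rowInsert, hx]

theorem mem_of_rowInsert_some {x y : ℕ} : ∀ {r : List ℕ}, (rowInsert x r).2 = some y → y ∈ r
  | [], h => by simp [rowInsert] at h
  | a :: r, h => by
    by_cases hx : x < a
    · simp [rowInsert, hx] at h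
      simp [h]
    · simp [rowInsert, hx] at h
      simp [mem_of_rowInsert_some h]

theorem rowInsert_none {x : ℕ} :
    ∀ {r : List ℕ}, (rowInsert x r).2 = none → (rowInsert x r).1 = r ++ [x]
  | [], _ => by simp [rowInsert]
  | a :: r, h => by
    by_cases hx : x < a
    · simp [rowInsert, hx] at h
    · simp [rowInsert, hx] at h
      simp [rowInsert, hx, rowInsert_none h]

theorem rowInsert_eq_none {x : ℕ} :
    ∀ {r : List ℕ}, (∀ a ∈ r, a ≤ x) → rowInsert x r = (r ++ [x], none)
  | [], _ => by simp [rowInsert]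
  | a :: r, h => by
    have hx : ¬ x < a := by simpa using h a (by simp)
    simp [rowInsert, hx, rowInsert_eq_none (fun b hb => h b (List.mem_cons_of_mem _ hb))]

theorem perm_rowInsert_none {x : ℕ} {r : List ℕ} (h : (rowInsert x r).2 = none) :
    (rowInsert x r).1.Perm (x :: r) := by
  rw [rowInsert_none h]
  exact List.perm_append_singleton x r

theorem perm_rowInsert_some {x y : ℕ} :
    ∀ {r : List ℕ}, (rowInsert x r).2 = some y → (y :: (rowInsert x r).1).Perm (x :: r)
  | [], h => by simp [rowInsert] at h
  | a :: r, h => by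
    by_cases hx : x < a
    · simp [rowInsert, hx] at h
      subst h
      simpa [rowInsert, hx] using List.Perm.swap x a r
    · simp [rowInsert, hx] at h
      simp only [rowInsert, hx, if_false]
      exact (List.Perm.swap _ _ _).trans
        (((perm_rowInsert_some h).cons a).trans (List.Perm.swap _ _ _))

/-- A smaller letter inserted after `x` bumps an entry that is at most `x`. -/
theorem rowInsert_bump_of_lt {x y : ℕ} (hyx : y < x) :
    ∀ {r : List ℕ}, ∃ v, (rowInsert y (rowInsert x r).1).2 = some v ∧ v ≤ x
  | [] => by simp [rowInsert, hyx]
  | a :: r => by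
    by_cases hx : x < a
    · simp [rowInsert, hx, hyx]
    · by_cases hy : y < a
      · simp [rowInsert, hx, hy]
        omega
      · simpa [rowInsert, hx, hy] using rowInsert_bump_of_lt hyx (r := r)

/-- The letter `y` lands to the right of the place taken by `x`, so in a sorted row it can only bump
something at least as large as what `x` bumped. -/
theorem rowInsert_bump_of_le {x y v : ℕ} (hxy : x ≤ y) :
    ∀ {r : List ℕ}, r.Pairwise (· ≤ ·) → (rowInsert y (rowInsert x r).1).2 = some v →
      ∃ u, (rowInsert x r).2 = some u ∧ u ≤ v
  | [], _, h => by
    have : ¬ y < x := by omega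
    simp [rowInsert, this] at h
  | a :: r, hr, h => by
    rw [List.pairwise_cons] at hr
    by_cases hx : x < a
    · have hy : ¬ y < x := by omega
      simp [rowInsert, hx, hy] at h
      simpa [rowInsert, hx] using hr.1 v (mem_of_rowInsert_some h)
    · have hy : ¬ y < a := by omega
      simp [rowInsert, hx, hy] at h ⊢
      exact rowInsert_bump_of_le hxy hr.2 h

/-! ### Reverse row insertion -/

/-- Reverse insertion of `y` into a row: `y` replaces the rightmost entry smaller than `y`, and
that entry is returned. -/
def revRow (y : ℕ) : List ℕ → Option (List ℕ × ℕ)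
  | [] => none
  | a :: r => if a < y then
      match revRow y r with
      | none => some (y :: r, a)
      | some (r', x) => some (a :: r', x)
    else none

theorem revRow_eq_none {y : ℕ} : ∀ {r : List ℕ}, (∀ a ∈ r, y ≤ a) → revRow y r = none
  | [], _ => rfl
  | a :: r, h => by
    have : ¬ a < y := by simpa using h a (by simp)
    simp [revRow, this]

theorem le_of_revRow_eq_none {y a : ℕ} {r : List ℕ} (h : revRow y (a :: r) = none) : y ≤ a := by
  by_contra! ha
  rcases hr : revRow y r with _ | ⟨r', x⟩ <;> simp [revRow, ha, hr] at h

theorem revRow_of_rowInsert {x y : ℕ} : ∀ {r : List ℕ}, r.Pairwise (· ≤ ·) →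
    (rowInsert x r).2 = some y → revRow y (rowInsert x r).1 = some (r, x)
  | [], _, h => by simp [rowInsert] at h
  | a :: r, hr, h => by
    rw [List.pairwise_cons] at hr
    by_cases hx : x < a
    · simp [rowInsert, hx] at h
      subst h
      simp [rowInsert, hx, revRow, revRow_eq_none hr.1]
    · simp [rowInsert, hx] at h
      have := lt_of_rowInsert h
      have ha : a < y := by omega
      simp [rowInsert, hx, revRow, ha, revRow_of_rowInsert hr.2 h]

/-- The last two conclusions serve the induction: `x ∈ r` makes the insertion of `x` pass the head,
and the control of the entries of `r'` keeps the row sorted. -/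
theorem rowInsert_of_revRow {x y : ℕ} : ∀ {r r' : List ℕ}, r.Pairwise (· ≤ ·) →
    revRow y r = some (r', x) →
      rowInsert x r' = (r, some y) ∧ r'.Pairwise (· ≤ ·) ∧ x ∈ r ∧ ∀ a ∈ r', a = y ∨ a ∈ r
  | [], r', _, h => by simp [revRow] at h
  | a :: r, r', hr, h => by
    rw [List.pairwise_cons] at hr
    by_cases ha : a < y
    · rcases hr' : revRow y r with _ | ⟨r₁, x₁⟩
      · simp only [revRow, ha, hr', if_true, Option.some.injEq, Prod.mk.injEq] at h
        obtain ⟨rfl, rfl⟩ := h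
        refine ⟨by simp [rowInsert, ha], ?_, by simp, ?_⟩
        · rw [List.pairwise_cons]
          refine ⟨?_, hr.2⟩
          cases r with
          | nil => simp
          | cons b r =>
            have hb := le_of_revRow_eq_none hr'
            intro c hc
            rcases List.mem_cons.1 hc with rfl | hc
            · exact hb
            · exact hb.trans ((List.pairwise_cons.1 hr.2).1 c hc)
        · intro b hb
          rcases List.mem_cons.1 hb with rfl | hb
          · simp
          · simp [hb]
      · simp only [revRow, ha, hr', if_true, Option.some.injEq, Prod.mk.injEq] at h
        obtain ⟨rfl, rfl⟩ := h
        obtain ⟨h1, h2, h3, h4⟩ := rowInsert_of_revRow hr.2 hr'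
        have hx : ¬ x₁ < a := by simpa using hr.1 _ h3
        refine ⟨by simp [rowInsert, hx, h1], ?_, by simp [h3], ?_⟩
        · rw [List.pairwise_cons]
          refine ⟨fun b hb => ?_, h2⟩
          rcases h4 b hb with rfl | hb
          · exact ha.le
          · exact hr.1 b hb
        · intro b hb
          rcases List.mem_cons.1 hb with rfl | hb
          · simp
          · rcases h4 b hb with h | h <;> simp [h]
    · simp [revRow, ha] at h

theorem Dom.revRow_of_forall_lt {x y : ℕ} : ∀ {r r' s : List ℕ}, Dom r s → (∀ b ∈ s, y < b) →
    revRow y r = some (r', x) → Dom r' s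
  | _, _, [], _, _, _ => by simp [Dom]
  | [], _, _ :: _, h, _, _ => h.elim
  | a :: r, r', b :: s, h, hs, hr => by
    by_cases ha : a < y
    · rcases hr' : revRow y r with _ | ⟨r₁, x₁⟩
      · simp only [revRow, ha, hr', if_true, Option.some.injEq, Prod.mk.injEq] at hr
        obtain ⟨rfl, rfl⟩ := hr
        exact ⟨hs b (by simp), h.2⟩
      · simp only [revRow, ha, hr', if_true, Option.some.injEq, Prod.mk.injEq] at hr
        obtain ⟨rfl, rfl⟩ := hr
        exact ⟨h.1, Dom.revRow_of_forall_lt h.2 (fun c hc => hs c (by simp [hc])) hr'⟩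
    · simp [revRow, ha] at hr

theorem exists_head_rowInsert_le (y : ℕ) (s : List ℕ) :
    ∃ b t, (rowInsert y s).1 = b :: t ∧ b ≤ y := by
  cases s with
  | nil => simp [rowInsert]
  | cons a s =>
    by_cases h : y < a
    · simp [rowInsert, h]
    · simp [rowInsert, h]
      omega

theorem Dom.exists_revRow {y : ℕ} {r s : List ℕ} (h : Dom r (rowInsert y s).1) :
    ∃ r' x, revRow y r = some (r', x) := by
  obtain ⟨b, t, hb, hby⟩ := exists_head_rowInsert_le y s
  rw [hb] at h
  cases r with
  | nil => exact h.elim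
  | cons a r =>
    have ha : a < y := lt_of_lt_of_le h.1 hby
    rcases hr' : revRow y r with _ | ⟨r₁, x₁⟩ <;> simp [revRow, ha, hr']

/-- If `y` sits in column `c` of the lower row, the entry of `r` above it is smaller than `y`. Hence
`y` moves up into column `c` or further right, where all entries of `s` exceed `y`. -/
theorem Dom.revRow {x y : ℕ} : ∀ {r r' s : List ℕ}, s.Pairwise (· ≤ ·) →
    Dom r (rowInsert y s).1 → revRow y r = some (r', x) → Dom r' s
  | _, _, [], _, _, _ => by simp [Dom]
  | [], _, b :: s, _, h, _ => by
    by_cases hy : y < b <;> simp [rowInsert, hy, Dom] at h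
  | a :: r, r', b :: s, hs, h, hr => by
    rw [List.pairwise_cons] at hs
    by_cases hy : y < b
    · simp only [rowInsert, hy, if_true] at h
      have ha : a < y := h.1
      rcases hr' : QPlancherel.revRow y r with _ | ⟨r₁, x₁⟩
      · simp only [QPlancherel.revRow, ha, hr', if_true, Option.some.injEq, Prod.mk.injEq] at hr
        obtain ⟨rfl, rfl⟩ := hr
        exact ⟨hy, h.2⟩
      · simp only [QPlancherel.revRow, ha, hr', if_true, Option.some.injEq, Prod.mk.injEq] at hr
        obtain ⟨rfl, rfl⟩ := hr
        exact ⟨ha.trans hy,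
          h.2.revRow_of_forall_lt (fun c hc => lt_of_lt_of_le hy (hs.1 c hc)) hr'⟩
    · simp only [rowInsert, hy, if_false] at h
      have ha : a < y := lt_of_lt_of_le h.1 (by omega)
      obtain ⟨r₁, x₁, hr'⟩ := h.2.exists_revRow
      simp only [QPlancherel.revRow, ha, hr', if_true, Option.some.injEq, Prod.mk.injEq] at hr
      obtain ⟨rfl, rfl⟩ := hr
      exact ⟨h.1, Dom.revRow hs.2 h.2 hr'⟩

theorem Dom.of_append_singleton {x : ℕ} : ∀ {r s : List ℕ}, Dom (r ++ [x]) s →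
    s.length ≤ r.length → Dom r s
  | _, [], _, _ => by simp [Dom]
  | [], _ :: _, _, h => by simp at h
  | _ :: _, _ :: _, h, hl => ⟨h.1, Dom.of_append_singleton h.2 (by simpa using hl)⟩

/-! ### Insertion into a tableau -/

/-- A semistandard tableau, given by the list of its rows. -/
structure IsTableau (T : List (List ℕ)) : Prop where
  ne_nil : ∀ r ∈ T, r ≠ []
  pairwise : ∀ r ∈ T, r.Pairwise (· ≤ ·)
  chain : T.IsChain Dom

theorem IsTableau.nil : IsTableau [] := ⟨by simp, by simp, List.isChain_nil⟩

theorem IsTableau.tail {r : List ℕ} {T : List (List ℕ)} (h : IsTableau (r :: T)) : IsTableau T :=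
  ⟨fun s hs => h.ne_nil s (by simp [hs]), fun s hs => h.pairwise s (by simp [hs]), h.chain.tail⟩

theorem IsTableau.cons {r : List ℕ} {T : List (List ℕ)} (hT : IsTableau T) (h0 : r ≠ [])
    (hr : r.Pairwise (· ≤ ·)) (hd : Dom r (T.headD [])) : IsTableau (r :: T) := by
  refine ⟨?_, ?_, ?_⟩
  · simpa [h0] using hT.ne_nil
  · simpa [hr] using hT.pairwise
  · cases T with
    | nil => simp
    | cons s T => exact List.isChain_cons_cons.2 ⟨hd, hT.chain⟩

theorem IsTableau.dom {r : List ℕ} {T : List (List ℕ)} (h : IsTableau (r :: T)) :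
    Dom r (T.headD []) := by
  cases T with
  | nil => simp [Dom]
  | cons s T => exact (List.isChain_cons_cons.1 h.chain).1

theorem IsTableau.insertTableau (x : ℕ) {T : List (List ℕ)} (hT : IsTableau T) :
    IsTableau (insertTableau x T) := by
  refine ⟨?_, ?_, isChain_insertTableau x T hT.chain⟩
  · have h := hT.ne_nil
    clear hT
    induction T generalizing x with
    | nil => simp [QPlancherel.insertTableau]
    | cons r T ih =>
      simp only [List.mem_cons, forall_eq_or_imp] at h
      cases hr : (rowInsert x r).2 with
      | none =>
        rw [insertTableau_cons_none hr]
        simpa [rowInsert_ne_nil] using h.2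
      | some y =>
        rw [insertTableau_cons_some hr]
        simpa [rowInsert_ne_nil] using ih y h.2
  · have h := hT.pairwise
    clear hT
    induction T generalizing x with
    | nil => simp [QPlancherel.insertTableau]
    | cons r T ih =>
      simp only [List.mem_cons, forall_eq_or_imp] at h
      cases hr : (rowInsert x r).2 with
      | none =>
        rw [insertTableau_cons_none hr]
        simpa [pairwise_rowInsert x h.1] using h.2
      | some y =>
        rw [insertTableau_cons_some hr]
        simpa [pairwise_rowInsert x h.1] using ih y h.2

theorem perm_flatten_insertTableau (x : ℕ) (T : List (List ℕ)) :
    (insertTableau x T).flatten.Perm (x :: T.flatten) := by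
  induction T generalizing x with
  | nil => simp [insertTableau]
  | cons r T ih =>
    cases hr : (rowInsert x r).2 with
    | none =>
      rw [insertTableau_cons_none hr]
      simpa using (perm_rowInsert_none hr).append_right T.flatten
    | some y =>
      rw [insertTableau_cons_some hr]
      simp only [List.flatten_cons]
      refine ((ih y).append_left _).trans ?_
      refine List.perm_middle.trans ?_
      simpa using (perm_rowInsert_some hr).append_right T.flatten

theorem headD_insertTableau (x : ℕ) (T : List (List ℕ)) :
    (insertTableau x T).headD [] = (rowInsert x (T.headD [])).1 := by
  cases T with
  | nil => simp [insertTableau, rowInsert]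
  | cons r T =>
    obtain ⟨T', h⟩ := head_insertTableau x r T
    simp [h]

/-- The row of the box that the insertion of `x` adds to a tableau. -/
def insRow (x : ℕ) : List (List ℕ) → ℕ
  | [] => 0
  | r :: T =>
    match (rowInsert x r).2 with
    | none => 0
    | some y => insRow y T + 1

theorem insRow_cons_none {x : ℕ} {r : List ℕ} {T : List (List ℕ)}
    (h : (rowInsert x r).2 = none) : insRow x (r :: T) = 0 := by
  simp [insRow, h]

theorem insRow_cons_some {x y : ℕ} {r : List ℕ} {T : List (List ℕ)}
    (h : (rowInsert x r).2 = some y) : insRow x (r :: T) = insRow y T + 1 := by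
  simp [insRow, h]

/-- The length of row `i`. -/
def rowLength (T : List (List ℕ)) (i : ℕ) : ℕ := (T.getD i []).length

theorem rowLength_insertTableau (x : ℕ) (T : List (List ℕ)) (i : ℕ) :
    rowLength (insertTableau x T) i = rowLength T i + if i = insRow x T then 1 else 0 := by
  induction T generalizing x i with
  | nil => cases i <;> simp [rowLength, insertTableau, insRow]
  | cons r T ih =>
    cases hr : (rowInsert x r).2 with
    | none =>
      rw [insertTableau_cons_none hr, insRow_cons_none hr]
      cases i <;> simp [rowLength, length_rowInsert_none hr]
    | some y =>
      rw [insertTableau_cons_some hr, insRow_cons_some hr]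
      cases i with
      | zero => simp [rowLength, length_rowInsert_some hr]
      | succ i => simpa [rowLength] using ih y i

/-! ### The row bumping lemma: descents and the rows of successive boxes. -/

theorem insRow_lt_insRow {x y : ℕ} (hyx : y < x) (T : List (List ℕ)) :
    insRow x T < insRow y (insertTableau x T) := by
  induction T generalizing x y with
  | nil => simp [insertTableau, insRow, rowInsert, hyx]
  | cons r T ih =>
    obtain ⟨v, hv, hvx⟩ := rowInsert_bump_of_lt hyx (r := r)
    cases hr : (rowInsert x r).2 with
    | none =>
      rw [insertTableau_cons_none hr, insRow_cons_none hr, insRow_cons_some hv]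
      omega
    | some u =>
      rw [insertTableau_cons_some hr, insRow_cons_some hr, insRow_cons_some hv]
      have := ih (lt_of_le_of_lt hvx (lt_of_rowInsert hr))
      omega

/-- The inequality `x ≤ y` passes to the bumped letters, and the bumping of `y` cannot go on in a
row where that of `x` has stopped. -/
theorem insRow_le_insRow {x y : ℕ} (hxy : x ≤ y) {T : List (List ℕ)} (hT : IsTableau T) :
    insRow y (insertTableau x T) ≤ insRow x T := by
  induction T generalizing x y with
  | nil =>
    have : ¬ y < x := by omega
    simp [insertTableau, insRow, rowInsert, this]
  | cons r T ih =>
    obtain ⟨T', hT'⟩ := head_insertTableau x r T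
    cases hv : (rowInsert y (rowInsert x r).1).2 with
    | none =>
      rw [hT', insRow_cons_none hv]
      omega
    | some v =>
      obtain ⟨u, hu, huv⟩ := rowInsert_bump_of_le hxy (hT.pairwise r (by simp)) hv
      rw [insertTableau_cons_some hu, insRow_cons_some hv, insRow_cons_some hu]
      have := ih huv hT.tail
      omega

theorem insRow_lt_insRow_iff {x y : ℕ} {T : List (List ℕ)} (hT : IsTableau T) :
    insRow x T < insRow y (insertTableau x T) ↔ y < x := by
  refine ⟨fun h => ?_, fun h => insRow_lt_insRow h T⟩
  by_contra! hxy
  have := insRow_le_insRow hxy hT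
  omega

/-! ### Undoing an insertion when the row of the new box is known. -/

theorem insertTableau_injective {x y : ℕ} {T S : List (List ℕ)} (hT : IsTableau T)
    (hS : IsTableau S) (h : insertTableau x T = insertTableau y S)
    (hr : insRow x T = insRow y S) : x = y ∧ T = S := by
  induction T generalizing x y S with
  | nil =>
    cases S with
    | nil => simpa [insertTableau] using h
    | cons s S =>
      cases hs : (rowInsert y s).2 with
      | none =>
        rw [insertTableau_cons_none hs, rowInsert_none hs] at h
        -- Insertion into a single empty row would give the same tableau as insertion into `[]`; the
        -- condition that rows are nonempty excludes it.
        have := hS.ne_nil s (by simp)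
        cases s with
        | nil => exact absurd rfl this
        | cons a s => simp [insertTableau] at h
      | some v =>
        rw [insRow_cons_some hs] at hr
        simp [insRow] at hr
  | cons r T ih =>
    cases S with
    | nil =>
      cases hs : (rowInsert x r).2 with
      | none =>
        rw [insertTableau_cons_none hs, rowInsert_none hs] at h
        have := hT.ne_nil r (by simp)
        cases r with
        | nil => exact absurd rfl this
        | cons a s => simp [insertTableau] at h
      | some v =>
        rw [insRow_cons_some hs] at hr
        simp [insRow] at hr
    | cons s S =>
      cases hu : (rowInsert x r).2 with
      | none =>
        cases hv : (rowInsert y s).2 with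
        | none =>
          rw [insertTableau_cons_none hu, insertTableau_cons_none hv, rowInsert_none hu,
            rowInsert_none hv, List.cons.injEq] at h
          have h1 := List.append_inj' h.1 rfl
          simp at h1
          exact ⟨h1.2, by rw [h1.1, h.2]⟩
        | some v =>
          rw [insRow_cons_none hu, insRow_cons_some hv] at hr
          omega
      | some u =>
        cases hv : (rowInsert y s).2 with
        | none =>
          rw [insRow_cons_some hu, insRow_cons_none hv] at hr
          omega
        | some v =>
          rw [insRow_cons_some hu, insRow_cons_some hv] at hr
          rw [insertTableau_cons_some hu, insertTableau_cons_some hv, List.cons.injEq] at h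
          obtain ⟨rfl, rfl⟩ := ih hT.tail hS.tail h.2 (by omega)
          have h1 := revRow_of_rowInsert (hT.pairwise r (by simp)) hu
          rw [h.1, revRow_of_rowInsert (hS.pairwise s (by simp)) hv] at h1
          simp at h1
          exact ⟨h1.2.symm, by rw [h1.1]⟩

/-- Reverse insertion from the last box of a row that is longer than the next one. -/
theorem exists_insertTableau_eq {T : List (List ℕ)} (hT : IsTableau T) {i : ℕ}
    (hi : rowLength T (i + 1) < rowLength T i) :
    ∃ x S, IsTableau S ∧ insertTableau x S = T ∧ insRow x S = i := by
  induction T generalizing i with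
  | nil => simp [rowLength] at hi
  | cons r T ih =>
    have hr := hT.pairwise r (by simp)
    cases i with
    | zero =>
      have hlen : (T.headD []).length < r.length := by
        cases T <;> simpa [rowLength] using hi
      obtain ⟨s, x, rfl⟩ : ∃ s x, r = s ++ [x] :=
        ⟨r.dropLast, r.getLast (hT.ne_nil r (by simp)),
          (List.dropLast_append_getLast _).symm⟩
      have hs := List.pairwise_append.1 hr
      have hx := rowInsert_eq_none (r := s) (x := x) (fun a ha => hs.2.2 a ha x (List.mem_singleton_self x))
      -- A row of one box must disappear from the list altogether; it is then the last row.
      cases s with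
      | nil =>
        cases T with
        | nil => exact ⟨x, [], IsTableau.nil, by simp [insertTableau], by simp [insRow]⟩
        | cons t T =>
          have := hT.ne_nil t (by simp)
          simp at hlen
          exact absurd hlen this
      | cons a s =>
        refine ⟨x, (a :: s) :: T, hT.tail.cons (by simp) hs.1
          (hT.dom.of_append_singleton ?_), ?_, ?_⟩
        · rw [List.length_append] at hlen
          exact Nat.lt_succ_iff.1 hlen
        · rw [insertTableau_cons_none (by rw [hx]), hx]
        · rw [insRow_cons_none (by rw [hx])]
    | succ i =>
      obtain ⟨y, S, hS, rfl, rfl⟩ := ih hT.tail (i := i) (by simpa [rowLength] using hi)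
      have hd := hT.dom
      rw [headD_insertTableau] at hd
      obtain ⟨r', x, hx⟩ := hd.exists_revRow
      obtain ⟨h1, h2, -, -⟩ := rowInsert_of_revRow hr hx
      have h3 : (S.headD []).Pairwise (· ≤ ·) := by
        cases S with
        | nil => simp
        | cons s S => exact hS.pairwise s (by simp)
      refine ⟨x, r' :: S, hS.cons ?_ h2 (hd.revRow h3 hx), ?_, ?_⟩
      · rintro rfl
        simp [rowInsert] at h1
      · rw [insertTableau_cons_some (by rw [h1]), h1]
      · rw [insRow_cons_some (by rw [h1])]

theorem rowLength_succ_le {T : List (List ℕ)} (hT : T.IsChain Dom) (i : ℕ) :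
    rowLength T (i + 1) ≤ rowLength T i := by
  induction T generalizing i with
  | nil => simp [rowLength]
  | cons r T ih =>
    cases i with
    | zero =>
      cases T with
      | nil => simp [rowLength]
      | cons s T => simpa [rowLength] using (List.isChain_cons_cons.1 hT).1.length_le
    | succ i => simpa [rowLength] using ih hT.tail i

theorem IsTableau.rowLength_insRow_lt {x : ℕ} {T : List (List ℕ)} (hT : IsTableau T) :
    rowLength (QPlancherel.insertTableau x T) (insRow x T + 1) <
      rowLength (QPlancherel.insertTableau x T) (insRow x T) := by
  have := rowLength_succ_le hT.chain (insRow x T)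
  simp only [rowLength_insertTableau, if_true]
  simp
  omega

theorem insRow_le_length (x : ℕ) (T : List (List ℕ)) : insRow x T ≤ T.length := by
  induction T generalizing x with
  | nil => simp [insRow]
  | cons r T ih =>
    cases hr : (rowInsert x r).2 with
    | none => simp [insRow_cons_none hr]
    | some y => simpa [insRow_cons_some hr] using ih y

end QPlancherel

namespace QPlancherel

/-! ### A determinant of Jacobi-Trudi type -/

/-- `(1 - q)(1 - q²) ⋯ (1 - qⁿ)` -/
noncomputable def qPoch (q : ℝ) (n : ℕ) : ℝ := ∏ i ∈ Finset.range n, (1 - q ^ (i + 1))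

theorem one_sub_pow_pos {q : ℝ} (hq0 : 0 < q) (hq1 : q < 1) {n : ℕ} (hn : n ≠ 0) :
    0 < 1 - q ^ n := sub_pos.2 (pow_lt_one₀ hq0.le hq1 hn)

theorem qPoch_pos {q : ℝ} (hq0 : 0 < q) (hq1 : q < 1) (n : ℕ) : 0 < qPoch q n :=
  Finset.prod_pos fun _ _ => one_sub_pow_pos hq0 hq1 (Nat.succ_ne_zero _)

theorem qPoch_succ (q : ℝ) (n : ℕ) : qPoch q (n + 1) = qPoch q n * (1 - q ^ (n + 1)) :=
  Finset.prod_range_succ _ _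

/-- The complete symmetric function `h_k(1, q, q², …)`. -/
noncomputable def complete (q : ℝ) : ℤ → ℝ
  | Int.ofNat k => (qPoch q k)⁻¹
  | Int.negSucc _ => 0

theorem complete_natCast (q : ℝ) (k : ℕ) : complete q k = (qPoch q k)⁻¹ := rfl

theorem complete_of_neg (q : ℝ) {k : ℤ} (hk : k < 0) : complete q k = 0 := by
  cases k with
  | ofNat k => exact absurd hk (by simp)
  | negSucc k => rfl

/-- Both sides are `h_k(q, q², …)`: on the left the variable `1` is removed, on the right
homogeneity of degree `k` is used. -/
theorem complete_sub {q : ℝ} (hq0 : 0 < q) (hq1 : q < 1) (k : ℤ) :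
    complete q k - complete q (k - 1) = q ^ k * complete q k := by
  rcases lt_trichotomy k 0 with hk | rfl | hk
  · rw [complete_of_neg q hk, complete_of_neg q (by omega)]
    simp
  · rw [complete_of_neg q (by omega : (0 : ℤ) - 1 < 0)]
    simp
  · obtain ⟨m, rfl⟩ : ∃ m : ℕ, k = ((m + 1 : ℕ) : ℤ) := ⟨(k - 1).toNat, by omega⟩
    rw [show ((m + 1 : ℕ) : ℤ) - 1 = (m : ℕ) by simp, complete_natCast, complete_natCast,
      zpow_natCast, qPoch_succ]
    have h1 := (qPoch_pos hq0 hq1 m).ne'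
    have h2 := (one_sub_pow_pos hq0 hq1 (Nat.succ_ne_zero m)).ne'
    field_simp
    ring

/-- The Jacobi-Trudi matrix of `a`, in which the rows before row `r` are evaluated at
`(q, q², …)` and the others at `(1, q, q², …)`. -/
noncomputable def jacobiTrudi (q : ℝ) (L : ℕ) (a : ℕ → ℤ) (r : ℕ) : Matrix (Fin L) (Fin L) ℝ :=
  Matrix.of fun i j => (if (i : ℕ) < r then q ^ (a i - i + j) else 1) * complete q (a i - i + j)

variable {q : ℝ} {L : ℕ}

/-- The matrices differ in row `r` only, so linearity in that row applies; by `complete_sub` the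
rows subtract to the row with index lowered by one. -/
theorem det_jacobiTrudi_sub (hq0 : 0 < q) (hq1 : q < 1) (a : ℕ → ℤ) {r : ℕ} (hr : r < L) :
    (jacobiTrudi q L a r).det - (jacobiTrudi q L a (r + 1)).det =
      (jacobiTrudi q L (fun i => a i - if i = r then 1 else 0) r).det := by
  have key : ∀ (s : ℕ) (b : ℕ → ℤ), (∀ i, i ≠ r → b i = a i) → (s = r ∨ s = r + 1) →
      jacobiTrudi q L b s =
        (jacobiTrudi q L a r).updateRow ⟨r, hr⟩ (jacobiTrudi q L b s ⟨r, hr⟩) := by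
    intro s b hb hs
    ext i j
    by_cases hi : i = ⟨r, hr⟩
    · subst hi; simp
    · have hi' : (i : ℕ) ≠ r := fun h => hi (Fin.ext h)
      rw [Matrix.updateRow_ne hi]
      have : (i : ℕ) < s ↔ (i : ℕ) < r := by omega
      simp [jacobiTrudi, hb i hi', this]
  rw [sub_eq_iff_eq_add, key r (fun i => a i - if i = r then 1 else 0) (by intro i hi; simp [hi])
    (Or.inl rfl), key (r + 1) a (by simp) (Or.inr rfl), ← Matrix.det_updateRow_add]
  conv_lhs => rw [key r a (by simp) (Or.inl rfl)]
  congr 2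
  ext j
  have := complete_sub hq0 hq1 (a r - r + j)
  have h2 : a r - 1 - r + j = a r - r + (j : ℤ) - 1 := by ring
  simp only [jacobiTrudi, Matrix.of_apply, Pi.add_apply, lt_irrefl, if_false, one_mul, if_true,
    Nat.lt_succ_self, h2]
  linarith

/-- Row `i` gives a factor `q^(a i - i)` and column `j` a factor `q^j`; the shifts cancel in the
product. -/
theorem det_jacobiTrudi_self (hq0 : 0 < q) (a : ℕ → ℤ) :
    (jacobiTrudi q L a L).det =
      q ^ (∑ i ∈ Finset.range L, a i) * (jacobiTrudi q L a 0).det := by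
  have h1 : jacobiTrudi q L a L = Matrix.of fun i j : Fin L => q ^ (j : ℤ) *
      (Matrix.of fun i j : Fin L => q ^ (a i - i) * jacobiTrudi q L a 0 i j) i j := by
    ext i j
    simp [jacobiTrudi, zpow_add₀ hq0.ne']
    ring
  rw [h1, Matrix.det_mul_row, Matrix.det_mul_column, ← mul_assoc, ← Finset.prod_mul_distrib]
  congr 1
  rw [← Fin.sum_univ_eq_sum_range]
  rw [← Finset.prod_congr rfl (fun (i : Fin L) _ => show q ^ (a i) = _ by
    rw [← zpow_add₀ hq0.ne']; congr 1; ring)]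
  induction (Finset.univ : Finset (Fin L)) using Finset.induction_on with
  | empty => simp
  | insert i s hi ih => rw [Finset.prod_insert hi, Finset.sum_insert hi, zpow_add₀ hq0.ne', ih]

/-- Lowering `a r` where there is no corner makes rows `r` and `r + 1` equal. In the last row of the
matrix it leaves only complete functions of negative degree. -/
theorem det_jacobiTrudi_eq_zero (a : ℕ → ℤ) {r : ℕ} (hr : r < L) (h0 : a (r + 1) = a r)
    (hlast : r + 1 = L → a r = 0) :
    (jacobiTrudi q L (fun i => a i - if i = r then 1 else 0) r).det = 0 := by
  by_cases h : r + 1 < L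
  · refine Matrix.det_zero_of_row_eq (i := ⟨r, hr⟩) (j := ⟨r + 1, h⟩) (by simp) ?_
    ext j
    simp [jacobiTrudi, h0]
    ring_nf
  · have hL : r + 1 = L := by omega
    refine Matrix.det_eq_zero_of_row_eq_zero ⟨r, hr⟩ fun j => ?_
    have := j.2
    simp [jacobiTrudi, hlast hL]
    exact complete_of_neg q (by omega)

theorem det_jacobiTrudi_zero (r : ℕ) : (jacobiTrudi q L (fun _ => 0) r).det = 1 := by
  rw [Matrix.det_of_isUpperTriangular]
  · refine Finset.prod_eq_one fun i _ => ?_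
    simp [jacobiTrudi, show complete q 0 = 1 by simpa [qPoch] using complete_natCast q 0]
  · intro i j hij
    have : (j : ℕ) < i := hij
    simp [jacobiTrudi, complete_of_neg q (show -(i : ℤ) + j < 0 by omega)]

end QPlancherel

namespace QPlancherel

/-! ### Words with a given insertion tableau

Words are written from right to left, so that the letter inserted last is the head. -/

/-- The insertion tableau of a reversed word. -/
def wordTableau (v : List ℕ) : List (List ℕ) := v.foldr insertTableau []

/-- The major index of a reversed word. -/
def revMaj : List ℕ → ℕ
  | [] => 0
  | [_] => 0
  | x :: y :: v => revMaj (y :: v) + if x < y then v.length + 1 else 0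

/-- The row of the box that was added last. -/
def lastRow : List ℕ → ℕ
  | [] => 0
  | x :: v => insRow x (wordTableau v)

theorem isTableau_wordTableau : ∀ v : List ℕ, IsTableau (wordTableau v)
  | [] => IsTableau.nil
  | x :: v => (isTableau_wordTableau v).insertTableau x

theorem wordTableau_cons (x : ℕ) (v : List ℕ) :
    wordTableau (x :: v) = insertTableau x (wordTableau v) := rfl

theorem perm_flatten_wordTableau : ∀ v : List ℕ, (wordTableau v).flatten.Perm v
  | [] => by simp [wordTableau]
  | x :: v => (perm_flatten_insertTableau x _).trans ((perm_flatten_wordTableau v).cons x)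

/-- The major index is read off from the rows of successive boxes. For empty `v` the default
`lastRow [] = 0` is harmless, since the weight `v.length` is zero. -/
theorem revMaj_cons (x : ℕ) (v : List ℕ) :
    revMaj (x :: v) =
      revMaj v + if lastRow v < insRow x (wordTableau v) then v.length else 0 := by
  cases v with
  | nil => simp [revMaj]
  | cons y v =>
    simp only [lastRow, wordTableau_cons, insRow_lt_insRow_iff (isTableau_wordTableau v)]
    rfl

/-- The reversed words whose insertion tableau is `T`. -/
def words (T : List (List ℕ)) : Finset (List ℕ) :=
  T.flatten.permutations.toFinset.filter fun v => wordTableau v = T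

theorem mem_words {T : List (List ℕ)} {v : List ℕ} : v ∈ words T ↔ wordTableau v = T := by
  simp only [words, Finset.mem_filter, List.mem_toFinset, List.mem_permutations,
    and_iff_right_iff_imp]
  rintro rfl
  exact (perm_flatten_wordTableau v).symm

theorem length_of_mem_words {T : List (List ℕ)} {v : List ℕ} (h : v ∈ words T) :
    v.length = T.flatten.length := by
  rw [← mem_words.1 h, (perm_flatten_wordTableau v).length_eq]

theorem length_le_length_flatten {T : List (List ℕ)} (h : ∀ r ∈ T, r ≠ []) :
    T.length ≤ T.flatten.length := by
  induction T with
  | nil => simp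
  | cons r T ih =>
    have h1 := ih fun s hs => h s (by simp [hs])
    have h2 := List.length_pos_iff.2 (h r (by simp))
    simp only [List.flatten_cons, List.length_cons, List.length_append]
    omega

theorem sum_rowLength {L : ℕ} {T : List (List ℕ)} (h : T.length ≤ L) :
    ∑ i ∈ Finset.range L, rowLength T i = T.flatten.length := by
  induction T generalizing L with
  | nil => simp [rowLength]
  | cons r T ih =>
    obtain ⟨L, rfl⟩ : ∃ M, L = M + 1 := ⟨L - 1, by simp at h; omega⟩
    have h1 := ih (L := L) (by simpa using h)
    rw [Finset.sum_range_succ', List.flatten_cons, List.length_append, ← h1]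
    simp [rowLength, add_comm]

/-! ### The sum over the words with a given insertion tableau. -/

theorem filter_words_eq_image {S : List (List ℕ)} (hS : IsTableau S) (x : ℕ) :
    (words (insertTableau x S)).filter (fun v => lastRow v = insRow x S) =
      (words S).image (x :: ·) := by
  ext v
  simp only [Finset.mem_filter, mem_words, Finset.mem_image]
  constructor
  · rintro ⟨h1, h2⟩
    cases v with
    | nil =>
      cases S with
      | nil => simp [wordTableau, insertTableau] at h1
      | cons s S =>
        obtain ⟨T', hT'⟩ := head_insertTableau x s S
        simp [wordTableau, hT'] at h1
    | cons y v =>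
      obtain ⟨rfl, rfl⟩ := insertTableau_injective (isTableau_wordTableau v) hS h1 h2
      exact ⟨v, rfl, rfl⟩
  · rintro ⟨v, rfl, rfl⟩
    exact ⟨rfl, rfl⟩

variable {q : ℝ} {L : ℕ}

theorem sum_words_lastRow_eq_zero {T : List (List ℕ)} (hT : T ≠ []) {r : ℕ}
    (hr : ¬ rowLength T (r + 1) < rowLength T r) :
    ∑ v ∈ words T with lastRow v = r, q ^ revMaj v = 0 := by
  rw [Finset.sum_eq_zero]
  intro v hv
  simp only [Finset.mem_filter, mem_words] at hv
  obtain ⟨rfl, rfl⟩ := hv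
  cases v with
  | nil => exact absurd rfl hT
  | cons x v => exact absurd (isTableau_wordTableau v).rowLength_insRow_lt hr

/-- The final `x` costs a factor `q^|S|` exactly when it creates a descent. This factor is charged
to every word, and the second term corrects the words without a new descent. -/
theorem sum_words_insertTableau {S : List (List ℕ)} (hS : IsTableau S) (x : ℕ) :
    ∑ v ∈ words (insertTableau x S) with lastRow v = insRow x S, q ^ revMaj v =
      q ^ S.flatten.length * ∑ v ∈ words S, q ^ revMaj v +
        (1 - q ^ S.flatten.length) *
          ∑ v ∈ words S with insRow x S ≤ lastRow v, q ^ revMaj v := by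
  rw [filter_words_eq_image hS, Finset.sum_image (fun _ _ _ _ h => (List.cons.inj h).2),
    Finset.sum_filter, Finset.mul_sum, Finset.mul_sum, ← Finset.sum_add_distrib]
  refine Finset.sum_congr rfl fun v hv => ?_
  rw [revMaj_cons, mem_words.1 hv, length_of_mem_words hv, pow_add]
  by_cases h : insRow x S ≤ lastRow v
  · simp only [h, not_lt.2 h, if_true, if_false]
    ring
  · simp [h, not_le.1 h, mul_comm]

/-- The second claim, on words whose last box is in row `r` or below, is what the induction needs:
it tells how many words acquire a descent. The factor `1 - q^n` is the one in
`sum_words_insertTableau`; it also makes the claim harmless for `n = 0`, where there is no last box.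
-/
theorem sum_words (hq0 : 0 < q) (hq1 : q < 1) {n : ℕ} (hn : n ≤ L) {T : List (List ℕ)}
    (hT : IsTableau T) (hTn : T.flatten.length = n) :
    (∑ v ∈ words T, q ^ revMaj v =
        qPoch q n * (jacobiTrudi q L (fun i => rowLength T i) 0).det) ∧
    ∀ r ≤ L, (1 - q ^ n) * ∑ v ∈ words T with r ≤ lastRow v, q ^ revMaj v =
      qPoch q n * ((jacobiTrudi q L (fun i => rowLength T i) r).det -
        q ^ n * (jacobiTrudi q L (fun i => rowLength T i) 0).det) := by
  induction n generalizing T with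
  | zero =>
    have hT0 : T = [] := by
      have := length_le_length_flatten hT.ne_nil
      rw [hTn] at this
      simpa using this
    subst hT0
    have h0 : (fun i => (rowLength [] i : ℤ)) = fun _ => 0 := by simp [rowLength]
    have hw : words [] = {[]} := by
      ext v
      rw [mem_words, Finset.mem_singleton]
      refine ⟨fun h => ?_, fun h => by simp [h, wordTableau]⟩
      have := (perm_flatten_wordTableau v).length_eq
      rw [h] at this
      simpa using this.symm
    rw [h0, hw]
    simp [det_jacobiTrudi_zero, revMaj, qPoch]
  | succ n ih =>
    have hTL := length_le_length_flatten hT.ne_nil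
    have hT0 : T ≠ [] := by rintro rfl; simp at hTn
    have step : ∀ r < L, ∑ v ∈ words T with lastRow v = r, q ^ revMaj v =
        qPoch q n * ((jacobiTrudi q L (fun i => rowLength T i) r).det -
          (jacobiTrudi q L (fun i => rowLength T i) (r + 1)).det) := by
      intro r hr
      rw [det_jacobiTrudi_sub hq0 hq1 _ hr]
      by_cases hc : rowLength T (r + 1) < rowLength T r
      · obtain ⟨x, S, hS, rfl, rfl⟩ := exists_insertTableau_eq hT hc
        have hSn : S.flatten.length = n := by
          have := (perm_flatten_insertTableau x S).length_eq
          simp only [List.length_cons] at this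
          omega
        obtain ⟨h1, h2⟩ := ih (by omega) hS hSn
        have hl : (fun i => ((rowLength (insertTableau x S) i : ℕ) : ℤ) -
            if i = insRow x S then 1 else 0) = fun i => (rowLength S i : ℤ) := by
          ext i
          rw [rowLength_insertTableau]
          split_ifs <;> simp
        -- The two terms with `q^n` times the unmixed determinant cancel, leaving the mixed
        -- determinant of the shape of `S`.
        rw [sum_words_insertTableau hS, hSn, h2 _ hr.le, h1, hl]
        ring
      · have h1 := rowLength_succ_le hT.chain r
        rw [sum_words_lastRow_eq_zero hT0 hc, det_jacobiTrudi_eq_zero _ hr, mul_zero]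
        · simp only [Nat.cast_inj]
          omega
        · intro h
          have h2 : rowLength T (r + 1) = 0 := by
            rw [rowLength, List.getD_eq_default _ _ (by omega), List.length_nil]
          simp only [Nat.cast_eq_zero]
          omega
    have tail : ∀ k r, r + k = L → ∑ v ∈ words T with r ≤ lastRow v, q ^ revMaj v =
        qPoch q n * ((jacobiTrudi q L (fun i => rowLength T i) r).det -
          (jacobiTrudi q L (fun i => rowLength T i) L).det) := by
      intro k
      induction k with
      | zero =>
        rintro r rfl
        -- The last box is in a row of index at most `n`, and `n + 1 ≤ L`, so no word remains.
        rw [add_zero, sub_self, mul_zero, Finset.sum_eq_zero]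
        intro v hv
        simp only [Finset.mem_filter] at hv
        have hl := length_of_mem_words hv.1
        cases v with
        | nil => simp [hTn] at hl
        | cons x v =>
          have h1 := insRow_le_length x (wordTableau v)
          have h2 := length_le_length_flatten (isTableau_wordTableau v).ne_nil
          have h3 := (perm_flatten_wordTableau v).length_eq
          have h4 := hv.2
          simp only [lastRow, List.length_cons] at h4 hl
          omega
      | succ k ihk =>
        intro r hr
        have hs : ∑ v ∈ words T with r ≤ lastRow v, q ^ revMaj v =
            ∑ v ∈ words T with lastRow v = r, q ^ revMaj v +
              ∑ v ∈ words T with r + 1 ≤ lastRow v, q ^ revMaj v := by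
          simp only [Finset.sum_filter]
          rw [← Finset.sum_add_distrib]
          refine Finset.sum_congr rfl fun v _ => ?_
          rcases lt_trichotomy (lastRow v) r with h | h | h
          · simp [h.ne, not_le.2 h, show ¬ r + 1 ≤ lastRow v by omega]
          · simp [h]
          · simp [h.ne', h.le, show r + 1 ≤ lastRow v by omega]
        rw [hs, step r (by omega), ihk (r + 1) (by omega)]
        ring
    have hL : (jacobiTrudi q L (fun i => rowLength T i) L).det =
        q ^ (n + 1) * (jacobiTrudi q L (fun i => rowLength T i) 0).det := by
      rw [det_jacobiTrudi_self hq0, ← Nat.cast_sum, sum_rowLength (by omega), hTn, zpow_natCast]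
    refine ⟨?_, fun r hr => ?_⟩
    · have := tail L 0 (by simp)
      simp only [zero_le, Finset.filter_true] at this
      rw [this, hL, qPoch_succ]
      ring
    · rw [tail (L - r) r (by omega), hL, qPoch_succ]
      ring

end QPlancherel

namespace QPlancherel

/-! ### The generating function of the major index -/

/-- The arrangements of the elements of `A`. -/
noncomputable def arrangements (A : Finset ℕ) : Finset (List ℕ) := A.toList.permutations.toFinset

theorem mem_arrangements {A : Finset ℕ} {v : List ℕ} :
    v ∈ arrangements A ↔ v.Perm A.toList := by
  rw [arrangements, List.mem_toFinset, List.mem_permutations]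

theorem cons_mem_arrangements {A : Finset ℕ} {x : ℕ} (hx : x ∈ A) {v : List ℕ} :
    x :: v ∈ arrangements A ↔ v ∈ arrangements (A.erase x) := by
  have h : A.toList.Perm (x :: (A.erase x).toList) := by
    conv_lhs => rw [← Finset.insert_erase hx]
    exact Finset.toList_insert (Finset.notMem_erase x A)
  rw [mem_arrangements, mem_arrangements, h.congr_right, List.perm_cons]

theorem length_of_mem_arrangements {A : Finset ℕ} {v : List ℕ} (h : v ∈ arrangements A) :
    v.length = A.card := by
  rw [(mem_arrangements.1 h).length_eq, Finset.length_toList]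

theorem filter_arrangements {A : Finset ℕ} {x : ℕ} (hx : x ∈ A) :
    (arrangements A).filter (fun v => v.head? = some x) =
      (arrangements (A.erase x)).image (x :: ·) := by
  ext v
  simp only [Finset.mem_filter, Finset.mem_image]
  constructor
  · rintro ⟨h1, h2⟩
    obtain ⟨w, rfl⟩ := List.head?_eq_some_iff.1 h2
    exact ⟨w, (cons_mem_arrangements hx).1 h1, rfl⟩
  · rintro ⟨w, hw, rfl⟩
    exact ⟨(cons_mem_arrangements hx).2 hw, rfl⟩

theorem sum_arrangements {A : Finset ℕ} (hA : A.Nonempty) (f : List ℕ → ℝ) :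
    ∑ v ∈ arrangements A, f v =
      ∑ x ∈ A, ∑ v ∈ arrangements A with v.head? = some x, f v := by
  simp only [Finset.sum_filter]
  rw [Finset.sum_comm]
  refine Finset.sum_congr rfl fun v hv => ?_
  cases v with
  | nil =>
    have := length_of_mem_arrangements hv
    simp only [List.length_nil] at this
    exact absurd this.symm (Finset.card_ne_zero.2 hA)
  | cons y v =>
    have : y ∈ A := by
      rw [← Finset.mem_toList, ← (mem_arrangements.1 hv).mem_iff]
      simp
    simp [this]

/-- The number of larger elements runs once through `0, …, |B| - 1`; a new maximum raises all old
counts by one. -/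
theorem sum_pow_card_filter_lt (q : ℝ) (B : Finset ℕ) :
    ∑ y ∈ B, q ^ (B.filter (y < ·)).card = ∑ k ∈ Finset.range B.card, q ^ k := by
  induction B using Finset.induction_on_max with
  | empty => simp
  | insert a s hs ih =>
    have ha : a ∉ s := fun h => (hs a h).false
    have h1 : (insert a s).filter (a < ·) = ∅ := by
      rw [Finset.filter_eq_empty_iff]
      intro y hy
      rcases Finset.mem_insert.1 hy with rfl | hy
      · exact lt_irrefl y
      · exact (hs y hy).not_gt
    have h2 : ∀ y ∈ s, ((insert a s).filter (y < ·)).card = (s.filter (y < ·)).card + 1 := by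
      intro y hy
      rw [Finset.filter_insert, if_pos (hs y hy), Finset.card_insert_of_notMem]
      exact fun h => ha (Finset.mem_filter.1 h).1
    rw [Finset.sum_insert ha, Finset.card_insert_of_notMem ha, Finset.sum_range_succ', h1,
      add_comm, Finset.sum_congr rfl fun y hy => by rw [h2 y hy, pow_succ], ← Finset.sum_mul, ih,
      Finset.sum_mul]
    simp [pow_succ]

/-- With `G` the letters above `x`, the exponents from letters below `x` fill `|G|, …, |B| - 1` and
those from `G` fill `|B|, …, |B| + |G| - 1`: together an unbroken run of length `|B|`. -/
theorem sum_pow_add_card_filter_lt (q : ℝ) {B : Finset ℕ} {x : ℕ} (hx : x ∉ B) :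
    ∑ y ∈ B, q ^ ((if x < y then B.card else 0) + (B.filter (y < ·)).card) =
      q ^ (B.filter (x < ·)).card * ∑ k ∈ Finset.range B.card, q ^ k := by
  set G := B.filter (x < ·) with hG
  set S := B.filter (¬ x < ·) with hS
  have hcard : B.card = S.card + G.card := by
    rw [add_comm]
    exact (Finset.card_filter_add_card_filter_not _).symm
  rw [← Finset.sum_filter_add_sum_filter_not B (x < ·), ← hG, ← hS]
  have h1 : ∀ y ∈ G, q ^ ((if x < y then B.card else 0) + (B.filter (y < ·)).card) =
      q ^ B.card * q ^ (G.filter (y < ·)).card := by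
    intro y hy
    have hxy : x < y := (Finset.mem_filter.1 hy).2
    rw [if_pos hxy, pow_add, hG, Finset.filter_filter]
    congr 3
    ext z
    simp only [Finset.mem_filter]
    exact ⟨fun h => ⟨h.1, hxy.trans h.2, h.2⟩, fun h => ⟨h.1, h.2.2⟩⟩
  have h2 : ∀ y ∈ S, q ^ ((if x < y then B.card else 0) + (B.filter (y < ·)).card) =
      q ^ G.card * q ^ (S.filter (y < ·)).card := by
    intro y hy
    obtain ⟨hyB, hxy⟩ := Finset.mem_filter.1 hy
    have hne : y ≠ x := fun h => hx (h ▸ hyB)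
    rw [if_neg hxy, zero_add, ← pow_add,
      ← Finset.card_filter_add_card_filter_not (s := B.filter (y < ·)) (x < ·), hG, hS,
      Finset.filter_filter, Finset.filter_filter, Finset.filter_filter]
    congr 3
    · ext z
      simp only [Finset.mem_filter]
      exact ⟨fun h => ⟨h.1, h.2.2⟩, fun h => ⟨h.1, by omega, h.2⟩⟩
    · ext z
      simp only [Finset.mem_filter]
      tauto
  rw [Finset.sum_congr rfl h1, Finset.sum_congr rfl h2, ← Finset.mul_sum, ← Finset.mul_sum,
    sum_pow_card_filter_lt, sum_pow_card_filter_lt, hcard, Finset.sum_range_add, mul_add]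
  simp only [pow_add, ← Finset.mul_sum]
  ring

variable {q : ℝ}

theorem qPoch_succ_div (hq1 : q < 1) (n : ℕ) :
    qPoch q (n + 1) / (1 - q) ^ (n + 1) =
      (∑ k ∈ Finset.range (n + 1), q ^ k) * (qPoch q n / (1 - q) ^ n) := by
  have h : (1 - q) ≠ 0 := (sub_pos.2 hq1).ne'
  rw [qPoch_succ, ← mul_neg_geom_sum q (n + 1), pow_succ]
  field_simp

/-- Fixing the last letter makes the recursion close, because a new descent depends only on the two
final letters. -/
theorem sum_arrangements_head (hq1 : q < 1) (n : ℕ) {A : Finset ℕ} (hA : A.card = n + 1) {x : ℕ}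
    (hx : x ∈ A) :
    ∑ v ∈ arrangements A with v.head? = some x, q ^ revMaj v =
      q ^ (A.filter (x < ·)).card * (qPoch q n / (1 - q) ^ n) := by
  induction n generalizing A x with
  | zero =>
    obtain ⟨y, rfl⟩ := Finset.card_eq_one.1 (by simpa using hA)
    obtain rfl := Finset.mem_singleton.1 hx
    rw [filter_arrangements hx]
    simp [arrangements, revMaj, qPoch, Finset.filter_singleton]
  | succ n ih =>
    have hB : (A.erase x).card = n + 1 := by rw [Finset.card_erase_of_mem hx, hA]; rfl
    have hxB := Finset.notMem_erase x A
    have hf : (A.erase x).filter (x < ·) = A.filter (x < ·) := by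
      ext y
      simp only [Finset.mem_filter, Finset.mem_erase]
      exact ⟨fun h => ⟨h.1.2, h.2⟩, fun h => ⟨⟨h.2.ne', h.1⟩, h.2⟩⟩
    rw [filter_arrangements hx, Finset.sum_image (fun _ _ _ _ h => (List.cons.inj h).2),
      sum_arrangements (Finset.card_pos.1 (by omega)), qPoch_succ_div hq1, ← mul_assoc, ← hf, ← hB,
      ← sum_pow_add_card_filter_lt q hxB, Finset.sum_mul]
    refine Finset.sum_congr rfl fun y hy => ?_
    rw [pow_add, mul_assoc, hB, ← ih hB hy, Finset.mul_sum]
    refine Finset.sum_congr rfl fun v hv => ?_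
    obtain ⟨hv, hy⟩ := Finset.mem_filter.1 hv
    have hl := length_of_mem_arrangements hv
    obtain ⟨w, rfl⟩ := List.head?_eq_some_iff.1 hy
    rw [hB, List.length_cons] at hl
    rw [revMaj, hl, pow_add, mul_comm]

/-- MacMahon's formula for the distribution of the major index. -/
theorem sum_arrangements_pow_revMaj (hq1 : q < 1) (A : Finset ℕ) :
    ∑ v ∈ arrangements A, q ^ revMaj v = qPoch q A.card / (1 - q) ^ A.card := by
  rcases A.eq_empty_or_nonempty with rfl | hA
  · simp [arrangements, revMaj, qPoch]
  · obtain ⟨n, hn⟩ : ∃ n, A.card = n + 1 := Nat.exists_eq_succ_of_ne_zero (Finset.card_ne_zero.2 hA)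
    rw [sum_arrangements hA, Finset.sum_congr rfl fun x hx => sum_arrangements_head hq1 n hn hx,
      ← Finset.sum_mul, sum_pow_card_filter_lt, hn, qPoch_succ_div hq1]

end QPlancherel

namespace QPlancherel

/-! ### The hook formula for the determinant -/

variable {q : ℝ}

/-- Up to the factor `1 / qPoch q l` this is a polynomial of degree `j` in `q^l`. The factor with `t
= l` makes it vanish for `j > l`, as it should. -/
theorem complete_natCast_sub (hq0 : 0 < q) (hq1 : q < 1) (l j : ℕ) :
    complete q ((l : ℤ) - j) =
      (qPoch q l)⁻¹ * ∏ t ∈ Finset.range j, (-(q ^ t)⁻¹ * (q ^ l - q ^ t)) := by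
  induction j with
  | zero => simp [complete_natCast]
  | succ j ih =>
    have h := complete_sub hq0 hq1 ((l : ℤ) - j)
    rw [zpow_sub₀ hq0.ne', zpow_natCast, zpow_natCast] at h
    rw [Finset.prod_range_succ, ← mul_assoc, ← ih]
    have h1 : (l : ℤ) - (j + 1 : ℕ) = l - j - 1 := by push_cast; ring
    have h2 : complete q ((l : ℤ) - j - 1) = complete q ((l : ℤ) - j) * (1 - q ^ l / q ^ j) := by
      linarith
    rw [h1, h2]
    have := (pow_pos hq0 j).ne'
    field_simp
    ring

theorem prod_Ioi_eq_prod_range {M : Type*} [CommMonoid M] (L : ℕ) (f : ℕ → ℕ → M) :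
    ∏ i : Fin L, ∏ j ∈ Finset.Ioi i, f i j =
      ∏ j ∈ Finset.range L, ∏ i ∈ Finset.range j, f i j := by
  have h1 : ∀ i : Fin L, ∏ j ∈ Finset.Ioi i, f i j =
      ∏ j : Fin L, if (i : ℕ) < j then f i j else 1 := by
    intro i
    rw [← Finset.prod_filter]
    refine Finset.prod_congr ?_ fun _ _ => rfl
    ext j
    simp
  rw [Finset.prod_congr rfl fun i _ => h1 i, Finset.prod_comm, ← Fin.prod_univ_eq_prod_range]
  refine Finset.prod_congr rfl fun j _ => ?_
  rw [Fin.prod_univ_eq_prod_range (fun i => if i < (j : ℕ) then f i j else 1), ← Finset.prod_filter]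
  refine Finset.prod_congr ?_ fun _ _ => rfl
  ext i
  have := j.2
  simp only [Finset.mem_filter, Finset.mem_range]
  omega

/-- Once row and column factors are extracted, column `j` holds a monic polynomial of degree `j` at
the points `q^(l i)`, so the determinant is that of Vandermonde. -/
theorem det_complete_natCast_sub (hq0 : 0 < q) (hq1 : q < 1) (L : ℕ) (l : ℕ → ℕ) :
    (Matrix.of fun i j : Fin L => complete q ((l i : ℤ) - (j : ℕ))).det =
      ∏ j ∈ Finset.range L, ((qPoch q (l j))⁻¹ *
        ∏ t ∈ Finset.range j, (-(q ^ t)⁻¹ * (q ^ l j - q ^ l t))) := by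
  let p : Fin L → Polynomial ℝ := fun j =>
    ∏ t ∈ Finset.range j, (Polynomial.X - Polynomial.C (q ^ t))
  have hm : ∀ j, (p j).Monic := fun j => Polynomial.monic_prod_X_sub_C _ _
  have hd : ∀ j, (p j).natDegree = j := fun j =>
    (Polynomial.natDegree_finsetProd_X_sub_C_eq_card _ _).trans (Finset.card_range _)
  have h1 : (Matrix.of fun i j : Fin L => complete q ((l i : ℤ) - (j : ℕ))) =
      Matrix.of fun i j : Fin L => (qPoch q (l i))⁻¹ *
        (Matrix.of fun i j : Fin L => (∏ t ∈ Finset.range j, (-(q ^ t)⁻¹)) *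
          (Matrix.of fun i j : Fin L => (p j).eval (q ^ l i)) i j) i j := by
    ext i j
    simp only [Matrix.of_apply]
    rw [complete_natCast_sub hq0 hq1, Finset.prod_mul_distrib, Polynomial.eval_prod]
    simp
  rw [h1, Matrix.det_mul_column, Matrix.det_mul_row,
    ← Matrix.det_eval_matrixOfPolynomials_eq_det_vandermonde (fun i : Fin L => q ^ l i) p hd hm,
    Matrix.det_vandermonde, prod_Ioi_eq_prod_range L (fun i j => q ^ l j - q ^ l i),
    Fin.prod_univ_eq_prod_range (fun i => (qPoch q (l i))⁻¹),
    Fin.prod_univ_eq_prod_range (fun j => ∏ t ∈ Finset.range j, (-(q ^ t)⁻¹)),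
    ← Finset.prod_mul_distrib, ← Finset.prod_mul_distrib]
  simp only [← Finset.prod_mul_distrib]

theorem prod_range_prod_range {M : Type*} [CommMonoid M] (L : ℕ) (g : ℕ → M) :
    ∏ j ∈ Finset.range L, ∏ t ∈ Finset.range j, g t =
      ∏ t ∈ Finset.range L, g t ^ (L - 1 - t) := by
  induction L with
  | zero => simp
  | succ L ih =>
    rw [Finset.prod_range_succ, Finset.prod_range_succ, ih, ← Finset.prod_mul_distrib]
    simp only [Nat.add_sub_cancel, Nat.sub_self, pow_zero, mul_one]
    refine Finset.prod_congr rfl fun t ht => ?_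
    have := Finset.mem_range.1 ht
    rw [← pow_succ]
    congr 1
    omega

/-- The hook lengths of a row and the differences of the numbers `λ_i + L - 1 - i` are complementary. -/
theorem prod_hooks_mul_prod_differences (q : ℝ) (μ : YoungDiagram) {L : ℕ}
    (hL : μ.colLen 0 ≤ L) {l : ℕ → ℕ} (hl : ∀ t, l t = μ.rowLen (L - 1 - t) + t) {j : ℕ}
    (hj : j < L) :
    (∏ c ∈ Finset.range (μ.rowLen (L - 1 - j)), (1 - q ^ hookLength μ (L - 1 - j, c))) *
      ∏ t ∈ Finset.range j, (1 - q ^ (l j - l t)) = qPoch q (l j) := by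
  set i := L - 1 - j with hi
  have hbox : ∀ {r c}, c < μ.rowLen r ↔ r < μ.colLen c := by
    intro r c
    rw [← YoungDiagram.mem_iff_lt_rowLen, YoungDiagram.mem_iff_lt_colLen]
  have hrow : ∀ {t}, t < j → μ.rowLen (L - 1 - t) ≤ μ.rowLen i := fun ht =>
    μ.rowLen_anti _ _ (by omega)
  have hcol : ∀ c, μ.colLen c ≤ L := fun c => (μ.colLen_anti 0 c (Nat.zero_le c)).trans hL
  have hinj1 : Set.InjOn (fun c => hookLength μ (i, c)) (Finset.range (μ.rowLen i)) := by
    refine StrictAntiOn.injOn fun c hc d hd hcd => ?_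
    have h1 := hbox.1 (Finset.mem_range.1 (Finset.mem_coe.1 hc))
    have h2 := hbox.1 (Finset.mem_range.1 (Finset.mem_coe.1 hd))
    have h3 := μ.colLen_anti c d hcd.le
    have h4 := Finset.mem_range.1 (Finset.mem_coe.1 hd)
    simp only [hookLength]
    omega
  have hinj2 : Set.InjOn (fun t => l j - l t) (Finset.range j) := by
    refine StrictAntiOn.injOn fun s hs t ht hst => ?_
    have h1 := hrow (Finset.mem_range.1 (Finset.mem_coe.1 ht))
    have h2 := Finset.mem_range.1 (Finset.mem_coe.1 ht)
    have h3 := μ.rowLen_anti (L - 1 - t) (L - 1 - s) (by omega)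
    simp only [hl]
    rw [← hi]
    omega
  have hdisj : Disjoint ((Finset.range (μ.rowLen i)).image fun c => hookLength μ (i, c))
      ((Finset.range j).image fun t => l j - l t) := by
    rw [Finset.disjoint_left]
    intro k hk hk'
    obtain ⟨c, hc, rfl⟩ := Finset.mem_image.1 hk
    obtain ⟨t, ht, hkt⟩ := Finset.mem_image.1 hk'
    rw [Finset.mem_range] at hc ht
    have h1 := hbox.1 hc
    have h2 := hrow ht
    have h3 := hcol c
    simp only [hl, hookLength, ← hi] at hkt
    -- The hook length exceeds the difference if `(L - 1 - t, c)` is a box and is smaller otherwise,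
    -- so they are never equal.
    by_cases h : c < μ.rowLen (L - 1 - t)
    · have h4 := hbox.1 h
      omega
    · have h4 := mt hbox.2 h
      omega
  have hunion : ((Finset.range (μ.rowLen i)).image fun c => hookLength μ (i, c)) ∪
      ((Finset.range j).image fun t => l j - l t) =
        (Finset.range (l j)).image (· + 1) := by
    -- The two disjoint sets have `λ_i + j = l j` elements in all, so inclusion in `{1, …, l j}`
    -- suffices.
    refine Finset.eq_of_subset_of_card_le ?_ ?_
    · intro k hk
      rw [Finset.mem_image]
      refine ⟨k - 1, ?_⟩
      rw [Finset.mem_range]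
      rcases Finset.mem_union.1 hk with hk | hk
      · obtain ⟨c, hc, rfl⟩ := Finset.mem_image.1 hk
        rw [Finset.mem_range] at hc
        have h1 := hbox.1 hc
        have h3 := hcol c
        simp only [hl, hookLength, ← hi]
        omega
      · obtain ⟨t, ht, rfl⟩ := Finset.mem_image.1 hk
        rw [Finset.mem_range] at ht
        have h2 := hrow ht
        simp only [hl, ← hi]
        omega
    · rw [Finset.card_union_of_disjoint hdisj, Finset.card_image_of_injOn hinj1,
        Finset.card_image_of_injOn hinj2, Finset.card_image_of_injective _ (add_left_injective 1)]
      simp only [Finset.card_range, hl, ← hi]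
      exact le_rfl
  rw [qPoch, ← Finset.prod_image (s := Finset.range (l j)) (g := (· + 1))
    (f := fun k => 1 - q ^ k) (add_left_injective 1).injOn, ← hunion, Finset.prod_union hdisj,
    Finset.prod_image hinj1, Finset.prod_image hinj2]

theorem hookLength_ne_zero {μ : YoungDiagram} {u : ℕ × ℕ} (hu : u ∈ μ) : hookLength μ u ≠ 0 := by
  have h1 := YoungDiagram.mem_iff_lt_rowLen.1 hu
  have h2 := YoungDiagram.mem_iff_lt_colLen.1 hu
  simp only [hookLength]
  omega

theorem rowLen_eq_zero {μ : YoungDiagram} {i : ℕ} (hi : μ.colLen 0 ≤ i) : μ.rowLen i = 0 := by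
  by_contra h
  have h1 : (i, 0) ∈ μ := YoungDiagram.mem_iff_lt_rowLen.2 (Nat.pos_of_ne_zero h)
  have h2 := YoungDiagram.mem_iff_lt_colLen.1 h1
  omega

theorem prod_cells {M : Type*} [CommMonoid M] (μ : YoungDiagram) {L : ℕ} (hL : μ.colLen 0 ≤ L)
    (f : ℕ × ℕ → M) :
    ∏ u ∈ μ.cells, f u = ∏ i ∈ Finset.range L, ∏ j ∈ Finset.range (μ.rowLen i), f (i, j) := by
  refine Finset.prod_finset_product _ _ _ fun u => ?_
  rw [YoungDiagram.mem_cells, Finset.mem_range, Finset.mem_range]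
  refine ⟨fun h => ?_, fun h => YoungDiagram.mem_iff_lt_rowLen.2 h.2⟩
  have h1 := YoungDiagram.mem_iff_lt_rowLen.1 h
  refine ⟨?_, h1⟩
  by_contra hu
  rw [rowLen_eq_zero (by omega)] at h1
  omega

theorem bStat_eq (μ : YoungDiagram) {L : ℕ} (hL : μ.colLen 0 ≤ L) :
    bStat μ = ∑ i ∈ Finset.range L, i * μ.rowLen i := by
  refine Finset.sum_subset (Finset.range_subset_range.2 hL) fun i _ hi => ?_
  rw [rowLen_eq_zero (by simpa using hi), mul_zero]

theorem det_jacobiTrudi_eq (hq0 : 0 < q) (hq1 : q < 1) (μ : YoungDiagram) {L : ℕ}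
    (hL : μ.colLen 0 ≤ L) :
    (jacobiTrudi q L (fun i => μ.rowLen i) 0).det =
      q ^ bStat μ / ∏ u ∈ μ.cells, (1 - q ^ hookLength μ u) := by
  let l : ℕ → ℕ := fun t => μ.rowLen (L - 1 - t) + t
  -- Reversing both rows and columns keeps the determinant and turns `λ_i - i + j` into `l i - j`.
  have h1 : (jacobiTrudi q L (fun i => μ.rowLen i) 0).submatrix Fin.revPerm Fin.revPerm =
      Matrix.of fun i j : Fin L => complete q ((l i : ℤ) - (j : ℕ)) := by
    ext i j
    have hi := i.2
    have hj := j.2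
    have h2 : (Fin.rev i : ℕ) = L - 1 - i := by rw [Fin.val_rev]; omega
    have h3 : (Fin.rev j : ℕ) = L - 1 - j := by rw [Fin.val_rev]; omega
    simp only [jacobiTrudi, Matrix.submatrix_apply, Matrix.of_apply, Fin.revPerm_apply, h2, h3,
      not_lt_zero, if_false, one_mul, l]
    congr 1
    push_cast
    omega
  rw [← Matrix.det_submatrix_equiv_self Fin.revPerm, h1, det_complete_natCast_sub hq0 hq1]
  have hb : q ^ bStat μ =
      ∏ j ∈ Finset.range L, ∏ t ∈ Finset.range j, q ^ μ.rowLen (L - 1 - t) := by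
    -- The row of index `L - 1 - t` occurs `L - 1 - t` times in the double product, which is its
    -- weight in `b(λ)`.
    rw [prod_range_prod_range, bStat_eq μ hL, ← Finset.prod_pow_eq_pow_sum,
      ← Finset.prod_range_reflect]
    exact Finset.prod_congr rfl fun t _ => by rw [← pow_mul, mul_comm]
  rw [hb, prod_cells μ hL, ← Finset.prod_range_reflect (fun i =>
    ∏ j ∈ Finset.range (μ.rowLen i), (1 - q ^ hookLength μ (i, j))) L, ← Finset.prod_div_distrib]
  refine Finset.prod_congr rfl fun j hj => ?_
  have hj := Finset.mem_range.1 hj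
  have hh := prod_hooks_mul_prod_differences q μ hL (l := l) (fun _ => rfl) hj
  have h4 : ∀ t ∈ Finset.range j, -(q ^ t)⁻¹ * (q ^ l j - q ^ l t) =
      q ^ μ.rowLen (L - 1 - t) * (1 - q ^ (l j - l t)) := by
    intro t ht
    rw [Finset.mem_range] at ht
    have h5 := μ.rowLen_anti (L - 1 - j) (L - 1 - t) (by omega)
    have h6 : q ^ l j = q ^ l t * q ^ (l j - l t) := by
      rw [← pow_add]
      congr 1
      simp only [l]
      omega
    have h7 : q ^ l t = q ^ μ.rowLen (L - 1 - t) * q ^ t := pow_add _ _ _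
    have := (pow_pos hq0 t).ne'
    rw [h6, h7]
    field_simp
    ring
  have h8 : ∏ c ∈ Finset.range (μ.rowLen (L - 1 - j)), (1 - q ^ hookLength μ (L - 1 - j, c)) ≠ 0 :=
    Finset.prod_ne_zero_iff.2 fun c hc => (one_sub_pow_pos hq0 hq1 (hookLength_ne_zero
      (YoungDiagram.mem_iff_lt_rowLen.2 (Finset.mem_range.1 hc)))).ne'
  have h9 := (qPoch_pos hq0 hq1 (l j)).ne'
  rw [Finset.prod_congr rfl h4, Finset.prod_mul_distrib, eq_div_iff h8]
  rw [← hh] at h9 ⊢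
  have h10 := right_ne_zero_of_mul h9
  field_simp

end QPlancherel

namespace QPlancherel

/-! ### Standard tableaux as lists of rows -/

theorem dom_iff : ∀ {r s : List ℕ},
    Dom r s ↔ s.length ≤ r.length ∧ ∀ j < s.length, r.getD j 0 < s.getD j 0
  | _, [] => by simp [Dom]
  | [], _ :: _ => by simp [Dom]
  | a :: r, b :: s => by
    rw [Dom, dom_iff (r := r) (s := s)]
    constructor
    · rintro ⟨h1, h2, h3⟩
      refine ⟨by simpa using h2, fun j hj => ?_⟩
      cases j with
      | zero => simpa using h1
      | succ j => simpa using h3 j (by simpa using hj)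
    · rintro ⟨h1, h2⟩
      refine ⟨by simpa using h2 0 (by simp), by simpa using h1, fun j hj => ?_⟩
      simpa using h2 (j + 1) (by simpa using hj)

/-- The lists of rows of the standard tableaux of shape `μ`. -/
abbrev RowTableau (μ : YoungDiagram) : Type :=
  {T : List (List ℕ) // IsTableau T ∧ T.flatten.Perm (List.range μ.card) ∧
    ∀ i, rowLength T i = μ.rowLen i}

variable {μ : YoungDiagram}

/-- The entry of a standard tableau, extended by `0` outside of the diagram. -/
noncomputable def StandardTableau.val (t : StandardTableau μ) (i j : ℕ) : ℕ :=
  open scoped Classical in if h : (i, j) ∈ μ then (t.entry ⟨(i, j), h⟩ : ℕ) else 0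

theorem StandardTableau.val_of_mem (t : StandardTableau μ) {i j : ℕ} (h : (i, j) ∈ μ) :
    t.val i j = t.entry ⟨(i, j), h⟩ := dif_pos h

/-- The list of the rows of a standard tableau. -/
noncomputable def StandardTableau.rows (t : StandardTableau μ) : List (List ℕ) :=
  (List.range (μ.colLen 0)).map fun i => (List.range (μ.rowLen i)).map (t.val i)

theorem mem_of_lt_rowLen {i j : ℕ} (h : j < μ.rowLen i) : (i, j) ∈ μ :=
  YoungDiagram.mem_iff_lt_rowLen.2 h

theorem rowLen_pos_iff {i : ℕ} : 0 < μ.rowLen i ↔ i < μ.colLen 0 := by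
  rw [← YoungDiagram.mem_iff_lt_rowLen, YoungDiagram.mem_iff_lt_colLen]

namespace StandardTableau

variable (t : StandardTableau μ)

theorem rows_getD (i : ℕ) : t.rows.getD i [] = (List.range (μ.rowLen i)).map (t.val i) := by
  by_cases h : i < μ.colLen 0
  · simp [rows, h]
  · rw [List.getD_eq_default _ _ (by simpa [rows] using h), rowLen_eq_zero (not_lt.1 h)]
    simp

theorem rowLength_rows (i : ℕ) : rowLength t.rows i = μ.rowLen i := by
  rw [rowLength, rows_getD]
  simp

theorem val_lt_of_row {i j k : ℕ} (hjk : j < k) (hk : k < μ.rowLen i) : t.val i j < t.val i k := by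
  rw [t.val_of_mem (mem_of_lt_rowLen (hjk.trans hk)), t.val_of_mem (mem_of_lt_rowLen hk)]
  exact t.row_lt _ _ rfl hjk

theorem val_lt_of_col {i j : ℕ} (hj : j < μ.rowLen (i + 1)) : t.val i j < t.val (i + 1) j := by
  have h := μ.rowLen_anti i (i + 1) (Nat.le_succ i)
  rw [t.val_of_mem (mem_of_lt_rowLen (hj.trans_le h)), t.val_of_mem (mem_of_lt_rowLen hj)]
  exact t.col_lt _ _ rfl (Nat.lt_succ_self i)

theorem val_injective {i j k l : ℕ} (hj : j < μ.rowLen i) (hl : l < μ.rowLen k)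
    (h : t.val i j = t.val k l) : i = k ∧ j = l := by
  rw [t.val_of_mem (mem_of_lt_rowLen hj), t.val_of_mem (mem_of_lt_rowLen hl)] at h
  have := t.entry.injective (Fin.ext h)
  simpa using this

theorem isTableau_rows : IsTableau t.rows := by
  refine ⟨?_, ?_, ?_⟩
  · intro r hr
    obtain ⟨i, hi, rfl⟩ := List.mem_map.1 hr
    have := rowLen_pos_iff.2 (List.mem_range.1 hi)
    simp only [ne_eq, List.map_eq_nil_iff, List.range_eq_nil]
    omega
  · intro r hr
    obtain ⟨i, hi, rfl⟩ := List.mem_map.1 hr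
    rw [List.pairwise_map]
    refine List.pairwise_lt_range.imp_of_mem fun _ hb hab => ?_
    exact (t.val_lt_of_row hab (List.mem_range.1 hb)).le
  · rw [List.isChain_iff_getElem]
    intro i hi
    simp only [rows, List.getElem_map, List.getElem_range]
    rw [dom_iff]
    simp only [List.length_map, List.length_range]
    refine ⟨μ.rowLen_anti i (i + 1) (Nat.le_succ i), fun j hj => ?_⟩
    have h := μ.rowLen_anti i (i + 1) (Nat.le_succ i)
    simpa [hj, hj.trans_le h] using t.val_lt_of_col hj

theorem perm_flatten_rows : t.rows.flatten.Perm (List.range μ.card) := by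
  rw [List.perm_ext_iff_of_nodup _ List.nodup_range]
  · intro x
    simp only [rows, List.mem_flatten, List.mem_map, List.mem_range]
    constructor
    · rintro ⟨_, ⟨i, hi, rfl⟩, hx⟩
      obtain ⟨j, hj, rfl⟩ := List.mem_map.1 hx
      rw [t.val_of_mem (mem_of_lt_rowLen (List.mem_range.1 hj))]
      exact Fin.is_lt _
    · intro hx
      obtain ⟨⟨⟨i, j⟩, h⟩, hu⟩ := t.entry.surjective ⟨x, hx⟩
      have hj := YoungDiagram.mem_iff_lt_rowLen.1 h
      refine ⟨_, ⟨i, rowLen_pos_iff.1 (by omega), rfl⟩,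
        List.mem_map.2 ⟨j, List.mem_range.2 hj, ?_⟩⟩
      rw [t.val_of_mem h, hu]
  · rw [List.nodup_flatten]
    constructor
    · intro r hr
      obtain ⟨i, hi, rfl⟩ := List.mem_map.1 hr
      refine List.Nodup.map_on (fun j hj k hk h => ?_) List.nodup_range
      exact (t.val_injective (List.mem_range.1 hj) (List.mem_range.1 hk) h).2
    · rw [rows, List.pairwise_map]
      refine List.pairwise_lt_range.imp fun {i k} hik => ?_
      intro x hx hx'
      obtain ⟨j, hj, rfl⟩ := List.mem_map.1 hx
      obtain ⟨l, hl, h⟩ := List.mem_map.1 hx'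
      have := (t.val_injective (List.mem_range.1 hl) (List.mem_range.1 hj) h).1
      omega

/-- A standard tableau, given by the list of its rows. -/
noncomputable def toRowTableau : RowTableau μ :=
  ⟨t.rows, t.isTableau_rows, t.perm_flatten_rows, t.rowLength_rows⟩

end StandardTableau

/-! ### The bijection between standard tableaux and their lists of rows. -/

theorem nat_card_boxes (μ : YoungDiagram) : Nat.card {u : ℕ × ℕ // u ∈ μ} = μ.card :=
  Nat.subtype_card μ.cells fun _ => YoungDiagram.mem_cells _

theorem StandardTableau.entry_injective :
    Function.Injective (StandardTableau.entry (μ := μ)) := by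
  rintro ⟨e, _, _⟩ ⟨e', _, _⟩ h
  simpa using h

instance (μ : YoungDiagram) : Finite (StandardTableau μ) :=
  have : Finite {u : ℕ × ℕ // u ∈ μ} := μ.cells.finite_toSet
  Finite.of_injective _ StandardTableau.entry_injective

theorem toRowTableau_injective :
    Function.Injective (StandardTableau.toRowTableau (μ := μ)) := by
  intro t t' h
  refine StandardTableau.entry_injective (Equiv.ext fun u => Fin.ext ?_)
  obtain ⟨⟨i, j⟩, hu⟩ := u
  have hj := YoungDiagram.mem_iff_lt_rowLen.1 hu
  rw [← t.val_of_mem hu, ← t'.val_of_mem hu]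
  have h1 : t.rows.getD i [] = t'.rows.getD i [] := by
    rw [show t.rows = t'.rows from congrArg Subtype.val h]
  rw [t.rows_getD, t'.rows_getD] at h1
  exact List.map_inj_left.1 h1 j (List.mem_range.2 hj)

theorem getD_getD_injective {T : List (List ℕ)} (hT : T.flatten.Nodup) {i j k l : ℕ}
    (hj : j < rowLength T i) (hl : l < rowLength T k)
    (h : (T.getD i []).getD j 0 = (T.getD k []).getD l 0) : i = k ∧ j = l := by
  have key : ∀ {i}, 0 < rowLength T i → i < T.length := by
    intro i hi
    by_contra hc
    rw [rowLength, List.getD_eq_default _ _ (not_lt.1 hc)] at hi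
    simp at hi
  have hi := key (Nat.zero_lt_of_lt hj)
  have hk := key (Nat.zero_lt_of_lt hl)
  rw [rowLength, List.getD_eq_getElem _ _ hi] at hj
  rw [rowLength, List.getD_eq_getElem _ _ hk] at hl
  rw [List.getD_eq_getElem _ _ hi, List.getD_eq_getElem _ _ hk, List.getD_eq_getElem _ _ hj,
    List.getD_eq_getElem _ _ hl] at h
  obtain ⟨h1, h2⟩ := List.nodup_flatten.1 hT
  have hik : i = k := by
    rw [List.pairwise_iff_getElem] at h2
    rcases lt_trichotomy i k with hik | hik | hik
    · exact absurd (h ▸ List.getElem_mem hl) (h2 i k hi hk hik (List.getElem_mem hj))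
    · exact hik
    · exact absurd (h ▸ List.getElem_mem hj) (h2 k i hk hi hik (List.getElem_mem hl))
  subst hik
  exact ⟨rfl, (List.Nodup.getElem_inj_iff (h1 _ (List.getElem_mem hi))).1 h⟩

/-- `IsTableau` asks only for weakly increasing rows; as the entries are a rearrangement of `0, …,
|μ| - 1`, they are distinct and the rows increase strictly. Columns increase because adjacent rows
are compared by `Dom`. -/
theorem toRowTableau_surjective :
    Function.Surjective (StandardTableau.toRowTableau (μ := μ)) := by
  rintro ⟨T, hT, hperm, hlen⟩
  have hnodup : T.flatten.Nodup := hperm.nodup_iff.2 List.nodup_range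
  let e : ℕ → ℕ → ℕ := fun i j => (T.getD i []).getD j 0
  have hlength : T.length = μ.colLen 0 := by
    refine eq_of_forall_lt_iff fun i => ?_
    rw [← rowLen_pos_iff, ← hlen]
    constructor
    · intro hi
      rw [rowLength, List.getD_eq_getElem _ _ hi]
      exact List.length_pos_iff.2 (hT.ne_nil _ (List.getElem_mem hi))
    · intro hi
      by_contra hc
      rw [rowLength, List.getD_eq_default _ _ (not_lt.1 hc)] at hi
      simp at hi
  have hbox : ∀ {i j}, (i, j) ∈ μ → i < T.length ∧ j < (T.getD i []).length := by
    intro i j h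
    have hj := YoungDiagram.mem_iff_lt_rowLen.1 h
    exact ⟨hlength ▸ rowLen_pos_iff.1 (by omega), by rw [← hlen] at hj; exact hj⟩
  have he : ∀ {i j}, (i, j) ∈ μ → e i j < μ.card := by
    intro i j h
    obtain ⟨hi, hj⟩ := hbox h
    rw [← List.mem_range, ← hperm.mem_iff, List.mem_flatten]
    refine ⟨T.getD i [], ?_, ?_⟩
    · rw [List.getD_eq_getElem _ _ hi]
      exact List.getElem_mem hi
    · simp only [e]
      rw [List.getD_eq_getElem _ _ hj]
      exact List.getElem_mem hj
  let f : {u : ℕ × ℕ // u ∈ μ} → Fin μ.card := fun u => ⟨e u.1.1 u.1.2, he u.2⟩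
  have hf : Function.Injective f := by
    rintro ⟨⟨i, j⟩, hu⟩ ⟨⟨k, l⟩, hv⟩ h
    have := getD_getD_injective hnodup (hbox hu).2 (hbox hv).2 (Fin.mk.inj_iff.1 h)
    simpa using this
  have hbij : Function.Bijective f :=
    hf.bijective_of_nat_card_le (by rw [nat_card_boxes, Nat.card_fin])
  have hrow : ∀ {i j k}, (i, k) ∈ μ → j < k → e i j < e i k := by
    intro i j k hk hjk
    have hj : (i, j) ∈ μ := μ.up_left_mem le_rfl hjk.le hk
    obtain ⟨hi, hkl⟩ := hbox hk
    refine lt_of_le_of_ne ?_ fun h => ?_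
    · have hp := hT.pairwise _ (List.getElem_mem hi)
      rw [List.getD_eq_getElem _ _ hi] at hkl
      simp only [e]
      rw [List.getD_eq_getElem _ _ hi, List.getD_eq_getElem _ _ hkl,
        List.getD_eq_getElem _ _ (hjk.trans hkl)]
      exact List.pairwise_iff_getElem.1 hp j k _ _ hjk
    · exact hjk.ne (getD_getD_injective hnodup (hbox hj).2 hkl h).2
  have hcol : ∀ {i k j}, (k, j) ∈ μ → i < k → e i j < e k j := by
    intro i k j hk hik
    induction k, hik using Nat.le_induction with
    | base =>
      obtain ⟨hi, hj⟩ := hbox hk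
      have hd := List.isChain_iff_getElem.1 hT.chain i hi
      rw [List.getD_eq_getElem _ _ hi] at hj
      have := (dom_iff.1 hd).2 j hj
      simp only [e]
      rwa [List.getD_eq_getElem _ _ hi, List.getD_eq_getElem _ _ (Nat.lt_of_succ_lt hi)]
    | succ k _ ih =>
      refine (ih (μ.up_left_mem (Nat.le_succ k) le_rfl hk)).trans ?_
      obtain ⟨hi, hj⟩ := hbox hk
      have hd := List.isChain_iff_getElem.1 hT.chain k hi
      rw [List.getD_eq_getElem _ _ hi] at hj
      have := (dom_iff.1 hd).2 j hj
      simp only [e]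
      rwa [List.getD_eq_getElem _ _ hi, List.getD_eq_getElem _ _ (Nat.lt_of_succ_lt hi)]
  let t : StandardTableau μ :=
    { entry := Equiv.ofBijective f hbij
      row_lt := by
        rintro ⟨⟨i, j⟩, hu⟩ ⟨⟨k, l⟩, hv⟩ rfl h
        exact hrow hv h
      col_lt := by
        rintro ⟨⟨i, j⟩, hu⟩ ⟨⟨k, l⟩, hv⟩ rfl h
        exact hcol hv h }
  refine ⟨t, Subtype.ext ?_⟩
  refine List.ext_getElem (by simp [StandardTableau.toRowTableau, StandardTableau.rows, hlength])
    fun i hi hi' => ?_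
  have h1 : (t.rows.getD i []) = T.getD i [] := by
    rw [t.rows_getD]
    refine List.ext_getElem (by rw [List.length_map, List.length_range, ← hlen]; rfl)
      fun j hj hj' => ?_
    have hj1 : j < μ.rowLen i := by simpa using hj
    simp only [List.getElem_map, List.getElem_range]
    rw [t.val_of_mem (mem_of_lt_rowLen hj1)]
    exact List.getD_eq_getElem _ _ hj'
  exact (List.getD_eq_getElem t.rows [] hi).symm.trans (h1.trans (List.getD_eq_getElem T [] hi'))

theorem nat_card_rowTableau (μ : YoungDiagram) : Nat.card (RowTableau μ) = dim μ :=
  (Nat.card_eq_of_bijective _ ⟨toRowTableau_injective, toRowTableau_surjective⟩).symm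

instance (μ : YoungDiagram) : Finite (RowTableau μ) :=
  Finite.of_surjective _ toRowTableau_surjective

/-! ### Permutations as words -/

/-- The reversed one-line notation of a permutation. -/
def revWord {n : ℕ} (σ : Equiv.Perm (Fin n)) : List ℕ := (List.ofFn fun i => (σ i : ℕ)).reverse

theorem pTableau_eq {n : ℕ} (σ : Equiv.Perm (Fin n)) : pTableau σ = wordTableau (revWord σ) := by
  rw [wordTableau, revWord, List.foldr_reverse]
  rfl

theorem revMaj_reverse_map_range (f : ℕ → ℕ) (n : ℕ) :
    revMaj ((List.range (n + 1)).map f).reverse =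
      ∑ i ∈ Finset.range n, if f (i + 1) < f i then i + 1 else 0 := by
  induction n with
  | zero => simp [revMaj]
  | succ n ih =>
    rw [Finset.sum_range_succ, ← ih]
    simp [List.range_succ, revMaj]

theorem maj_eq {n : ℕ} (σ : Equiv.Perm (Fin n)) : maj σ = revMaj (revWord σ) := by
  cases n with
  | zero => simp [maj, revWord, revMaj]
  | succ n =>
    let f : ℕ → ℕ := fun i => if h : i < n + 1 then (σ ⟨i, h⟩ : ℕ) else 0
    have h1 : (List.ofFn fun i => (σ i : ℕ)) = (List.range (n + 1)).map f := by
      refine List.ext_getElem (by simp) fun i h1 h2 => ?_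
      have : i < n + 1 := by simpa using h1
      rw [List.getElem_ofFn, List.getElem_map, List.getElem_range]
      simp only [f, this, dif_pos]
    rw [revWord, h1, revMaj_reverse_map_range, maj, Fin.sum_univ_castSucc,
      ← Fin.sum_univ_eq_sum_range (fun i => if f (i + 1) < f i then i + 1 else 0)]
    simp only [Fin.val_last, lt_irrefl, IsEmpty.exists_iff, if_false, add_zero]
    refine Finset.sum_congr rfl fun i _ => ?_
    have h2 : (i : ℕ) + 1 < n + 1 := by omega
    have h3 : (i : ℕ) < n + 1 := by omega
    simp only [f, h2, h3, dif_pos, Fin.val_castSucc, exists_true_left, Fin.val_fin_lt]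
    rfl

theorem revWord_injective (n : ℕ) : Function.Injective (revWord (n := n)) := by
  intro σ τ h
  have h1 := List.ofFn_injective (List.reverse_injective h)
  exact Equiv.ext fun i => Fin.ext (congrFun h1 i)

theorem image_revWord (n : ℕ) :
    Finset.univ.image (revWord (n := n)) = arrangements (Finset.range n) := by
  refine Finset.eq_of_subset_of_card_le ?_ ?_
  · intro v hv
    obtain ⟨σ, -, rfl⟩ := Finset.mem_image.1 hv
    rw [mem_arrangements, List.perm_ext_iff_of_nodup _ (Finset.nodup_toList _)]
    · intro x
      simp only [revWord, List.mem_reverse, List.mem_ofFn, Finset.mem_toList, Finset.mem_range]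
      constructor
      · rintro ⟨i, rfl⟩
        exact Fin.is_lt _
      · intro hx
        exact ⟨σ.symm ⟨x, hx⟩, by simp⟩
    · rw [revWord, List.nodup_reverse, List.nodup_ofFn]
      exact Fin.val_injective.comp σ.injective
  -- There are `n!` words of permutations and at most `n!` arrangements, so the inclusion is an
  -- equality.
  · rw [Finset.card_image_of_injective _ (revWord_injective n), Finset.card_univ,
      Fintype.card_perm, Fintype.card_fin]
    refine (List.toFinset_card_le _).trans ?_
    rw [List.length_permutations, Finset.length_toList, Finset.card_range]

theorem rowLen_ofRowLens_map_length (T : List (List ℕ)) (h : (T.map List.length).SortedGE) (i : ℕ) :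
    (YoungDiagram.ofRowLens (T.map List.length) h).rowLen i = rowLength T i := by
  refine eq_of_forall_lt_iff fun c => ?_
  rw [← YoungDiagram.mem_iff_lt_rowLen, YoungDiagram.mem_ofRowLens]
  by_cases hi : i < T.length
  · simp [rowLength, hi]
  · simp [rowLength, hi]

theorem ext_rowLen {μ ν : YoungDiagram} (h : ∀ i, μ.rowLen i = ν.rowLen i) : μ = ν := by
  ext ⟨i, j⟩
  rw [YoungDiagram.mem_cells, YoungDiagram.mem_cells, YoungDiagram.mem_iff_lt_rowLen, h,
    YoungDiagram.mem_iff_lt_rowLen]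

theorem rskShape_eq_iff {n : ℕ} (σ : Equiv.Perm (Fin n)) (μ : Diagram n) :
    rskShape σ = μ ↔ ∀ i, rowLength (wordTableau (revWord σ)) i = μ.1.rowLen i := by
  rw [Subtype.ext_iff, rskShape, ← pTableau_eq]
  simp only [← rowLen_ofRowLens_map_length _
    (sortedGE_lengths _ (foldl_insertTableau _ [] List.isChain_nil).1 :
      ((pTableau σ).map List.length).SortedGE)]
  exact ⟨fun h i => by rw [h], ext_rowLen⟩

end QPlancherel

namespace QPlancherel

variable {q : ℝ}

/-! ### The distribution of the shape -/

theorem sum_pow_maj (hq1 : q < 1) (n : ℕ) :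
    ∑ σ : Equiv.Perm (Fin n), q ^ maj σ = qPoch q n / (1 - q) ^ n := by
  have h := sum_arrangements_pow_revMaj hq1 (Finset.range n)
  rw [Finset.card_range, ← image_revWord, Finset.sum_image (revWord_injective n).injOn] at h
  simpa only [maj_eq] using h

theorem sum_words_eq (hq0 : 0 < q) (hq1 : q < 1) {μ : YoungDiagram} (T : RowTableau μ) :
    ∑ v ∈ words T.1, q ^ revMaj v = qPoch q μ.card *
      (q ^ bStat μ / ∏ u ∈ μ.cells, (1 - q ^ hookLength μ u)) := by
  obtain ⟨T, hT, hperm, hlen⟩ := T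
  have hn : T.flatten.length = μ.card := by rw [hperm.length_eq, List.length_range]
  -- The matrix size is a maximum because `sum_words` needs at least `n` rows and the hook formula
  -- at least the number of rows of `μ`.
  rw [← det_jacobiTrudi_eq hq0 hq1 μ (le_max_right μ.card (μ.colLen 0)),
    (sum_words hq0 hq1 (le_max_left μ.card (μ.colLen 0)) hT hn).1]
  simp only [hlen]

/-- The words of a given shape split into fibres over the standard tableaux of that shape, which is
where `dim` enters. -/
theorem filter_arrangements_eq_biUnion (μ : YoungDiagram) [Fintype (RowTableau μ)]
    [DecidablePred fun v : List ℕ => ∀ i, rowLength (wordTableau v) i = μ.rowLen i] :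
    (arrangements (Finset.range μ.card)).filter
        (fun v => ∀ i, rowLength (wordTableau v) i = μ.rowLen i) =
      Finset.univ.biUnion fun T : RowTableau μ => words T.1 := by
  have hr : (Finset.range μ.card).toList.Perm (List.range μ.card) := by
    rw [List.perm_ext_iff_of_nodup (Finset.nodup_toList _) List.nodup_range]
    simp
  ext v
  simp only [Finset.mem_filter, mem_arrangements, Finset.mem_biUnion, Finset.mem_univ, true_and,
    mem_words]
  constructor
  · rintro ⟨h1, h2⟩
    exact ⟨⟨wordTableau v, isTableau_wordTableau v,
      (perm_flatten_wordTableau v).trans (h1.trans hr), h2⟩, rfl⟩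
  · rintro ⟨⟨T, -, h1, h2⟩, rfl⟩
    exact ⟨(perm_flatten_wordTableau v).symm.trans (h1.trans hr.symm), h2⟩

theorem sum_pow_maj_rskShape (hq0 : 0 < q) (hq1 : q < 1) {n : ℕ} [DecidableEq (Diagram n)]
    (μ : Diagram n) :
    ∑ σ : Equiv.Perm (Fin n), (if μ = rskShape σ then q ^ maj σ else 0) =
      dim μ.1 * (qPoch q n * (q ^ bStat μ.1 / ∏ u ∈ μ.1.cells, (1 - q ^ hookLength μ.1 u))) := by
  classical
  have : Fintype (RowTableau μ.1) := Fintype.ofFinite _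
  have h1 : ∑ σ : Equiv.Perm (Fin n), (if μ = rskShape σ then q ^ maj σ else 0) =
      ∑ v ∈ (arrangements (Finset.range μ.1.card)).filter
        (fun v => ∀ i, rowLength (wordTableau v) i = μ.1.rowLen i), q ^ revMaj v := by
    rw [μ.2, Finset.sum_filter, ← image_revWord, Finset.sum_image (revWord_injective n).injOn]
    refine Finset.sum_congr rfl fun σ _ => ?_
    rw [maj_eq]
    refine if_congr ?_ rfl rfl
    rw [eq_comm, rskShape_eq_iff]
  rw [h1, filter_arrangements_eq_biUnion, Finset.sum_biUnion,
    Finset.sum_congr rfl fun T _ => sum_words_eq hq0 hq1 T, Finset.sum_const, Finset.card_univ,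
    ← Nat.card_eq_fintype_card, nat_card_rowTableau, nsmul_eq_mul, μ.2]
  intro S _ T _ hST
  rw [Function.onFun, Finset.disjoint_left]
  intro v hv hv'
  exact hST (Subtype.ext ((mem_words.1 hv).symm.trans (mem_words.1 hv')))

theorem qPlancherel_nonneg (hq0 : 0 < q) (hq1 : q < 1) {n : ℕ} (μ : Diagram n) :
    0 ≤ qPlancherel n q μ := by
  have h1 : 0 ≤ 1 - q := (sub_pos.2 hq1).le
  have h2 : 0 ≤ ∏ u ∈ μ.1.cells, (1 - q ^ hookLength μ.1 u) :=
    Finset.prod_nonneg fun u hu =>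
      (one_sub_pow_pos hq0 hq1 (hookLength_ne_zero ((YoungDiagram.mem_cells _).1 hu))).le
  exact mul_nonneg (by positivity) (by positivity)

theorem map_rskShape_majPMF (hq0 : 0 < q) (hq1 : q < 1) {n : ℕ} (μ : Diagram n) :
    ((majPMF n q hq0).map rskShape) μ = ENNReal.ofReal (qPlancherel n q μ) := by
  classical
  have hZ : 0 < ∑ τ : Equiv.Perm (Fin n), q ^ maj τ :=
    Finset.sum_pos (fun _ _ => pow_pos hq0 _) Finset.univ_nonempty
  have h1 : ∀ σ : Equiv.Perm (Fin n), (if μ = rskShape σ then majPMF n q hq0 σ else 0) =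
      ENNReal.ofReal ((if μ = rskShape σ then q ^ maj σ else 0) /
        ∑ τ : Equiv.Perm (Fin n), q ^ maj τ) := by
    intro σ
    split_ifs
    · rfl
    · simp
  have h2 : qPlancherel n q μ = (∑ σ : Equiv.Perm (Fin n), if μ = rskShape σ then q ^ maj σ else 0) /
      ∑ τ : Equiv.Perm (Fin n), q ^ maj τ := by
    rw [sum_pow_maj_rskShape hq0 hq1, sum_pow_maj hq1, qPlancherel]
    have h3 := (qPoch_pos hq0 hq1 n).ne'
    have h4 := (sub_pos.2 hq1).ne'
    field_simp
  rw [PMF.map_apply, tsum_fintype, h2, Finset.sum_div,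
    ENNReal.ofReal_sum_of_nonneg fun σ _ => ?_]
  · refine Finset.sum_congr rfl fun σ _ => ?_
    rw [← h1]
    congr
  · split_ifs <;> positivity

end QPlancherel

theorem mainTheorem5 (n : ℕ) (q : ℝ) (hq0 : 0 < q) (hq1 : q < 1) :
    (∀ μ : QPlancherel.Diagram n, 0 ≤ QPlancherel.qPlancherel n q μ) ∧
    HasSum (fun μ : QPlancherel.Diagram n => QPlancherel.qPlancherel n q μ) 1 ∧
    ∀ μ : QPlancherel.Diagram n,
      ((QPlancherel.majPMF n q hq0).map QPlancherel.rskShape) μ =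
        ENNReal.ofReal (QPlancherel.qPlancherel n q μ) := by
  have h0 := fun μ : QPlancherel.Diagram n => QPlancherel.qPlancherel_nonneg hq0 hq1 μ
  have h1 := fun μ : QPlancherel.Diagram n => QPlancherel.map_rskShape_majPMF hq0 hq1 μ
  refine ⟨h0, ?_, h1⟩
  -- The total mass comes for free: a push-forward of a probability distribution has mass one, and
  -- the values are finite, so the sum passes from `ENNReal` to the reals.
  have h2 := ((QPlancherel.majPMF n q hq0).map QPlancherel.rskShape).hasSum_coe_one
  rw [funext h1] at h2
  have h3 := ENNReal.hasSum_toReal (h2.tsum_eq ▸ ENNReal.one_ne_top)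
  rw [← ENNReal.tsum_toReal_eq fun _ => ENNReal.ofReal_ne_top, h2.tsum_eq] at h3
  simpa [ENNReal.toReal_ofReal, h0] using h3
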